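/- Call a rational $n$-tuple $(\varphi_1,\dots,\varphi_n)\in\mathbb Q^n$ an \emph{irreducible solution} of $$\text{(C)}\ \ \sum_{j=1}^n\cos 2\pi\varphi_j=0\qquad\Bigl(\text{resp. of (E)}\ \ \sum_{j=1}^n e^{2\pi i\varphi_j}=0\Bigr)$$ if it satisfies the equation while $\sum_{j\in E}\cos2\pi\varphi_j\ne0$ (resp. $\sum_{j\in E}e^{2\pi i\varphi_j}\neq0$) for every nonempty proper subset $E\subset\{1,\dots,n\}$. Entries are considered modulo $1$. For (E), two $n$-tuples are equivalent if they differ by a permutation. For (C), two $n$-tuples are equivalent if they are related by permutations, changes $\varphi_j\mapsto 1-\varphi_j$ of individual entries, and the simultaneous change $\varphi_j\mapsto\frac12-\varphi_j$ of all entries. \textbf{(1)} For $1\le n\le 6$, a rational $n$-tuple is an irreducible solution of (E) if and only if it is equivalent to one of the following, for some $\varphi\in\mathbb Q$: \begin{itemize} \item $(\varphi-\frac16,\varphi+\frac16,\varphi+\frac15,\varphi+\frac25,\varphi+\frac35,\varphi+\frac45)$, \item $(\varphi,\varphi+\frac15,\varphi+\frac25,\varphi+\frac35,\varphi+\frac45)$,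 \item $(\varphi,\varphi+\frac13,\varphi+\frac23)$, \item $(\varphi,\varphi+\frac12)$. \end{itemize} \textbf{(2)} For $1<n\le6$, every irreducible rational solution of (C) is equivalent to one of the following: \begin{itemize} \item one of the 13 sporadic 6-tuples $(\frac1{11},\frac2{11},\frac3{11},\frac4{11},\frac5{11},\frac16)$; $(\frac L7+\frac16,\frac L7-\frac16,\frac{2L}7,\frac{3L}7,0,\frac13)$, $(\frac L7+\frac16,\frac L7-\frac16,\frac{2L}7,\frac{3L}7,\frac1{10},\frac3{10})$, $(\frac L7+\frac16,\frac L7-\frac16,\frac{2L}7+\frac16,\frac{2L}7-\frac16,\frac{3L}7,\frac16)$ with $L=1,2,3$; $(\frac17,\frac27,\frac37,0,\frac15,\frac25)$, $(\frac17,\frac27,\frac37,\frac1{15},\frac4{15},\frac3{10})$, $(\frac17,\frac27,\frac37,\frac1{10},\frac2{15},\frac7{15})$; or a member of the family $\mathrm{VI}_\varphi=(\varphi+\frac16,\varphi-\frac16,\varphi+\frac15,\varphi+\frac25,\varphi+\frac35,\varphi+\frac45)$, $\varphi\in\mathbb Q$; \item one of the 7 sporadic 5-tuples $(0,\frac1{30},\frac13,\frac{11}{30},\frac25)$,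 $(0,\frac15,\frac7{30},\frac13,\frac{13}{30})$; $(\frac L7+\frac16,\frac L7-\frac16,\frac{2L}7,\frac{3L}7,\frac16)$ with $L=1,2,3$; $(\frac17,\frac27,\frac37,0,\frac13)$, $(\frac17,\frac27,\frac37,\frac1{10},\frac3{10})$; or a member of the family $\mathrm V_\varphi=(\varphi,\varphi+\frac15,\varphi+\frac25,\varphi+\frac35,\varphi+\frac45)$, $\varphi\in\mathbb Q$; \item one of the 4 sporadic quadruples $(0,\frac15,\frac13,\frac25)$, $(\frac1{30},\frac16,\frac{11}{30},\frac25)$, $(\frac1{15},\frac4{15},\frac3{10},\frac13)$, $(\frac17,\frac27,\frac37,\frac16)$; \item the sporadic triple $\mathrm{III}_1=(\frac1{10},\frac3{10},\frac13)$, or a member of the family $\mathrm{III}_\varphi=(\varphi,\varphi+\frac13,\varphi-\frac13)$, $\varphi\in\mathbb Q$; \item a member of the family of pairs $\mathrm{II}_\varphi=(\varphi,\frac12-\varphi)$, $\varphi\in\mathbb Q$. \end{itemize} Moreover, all sporadic tuples listed are irreducible solutions of (C), they are pairwise inequivalent, and none of them is equivalent to a member of a family. Every member of each family is a solution of (C),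 and within each family it is irreducible for all but finitely many $\varphi\in\mathbb Q\cap[0,1)$. -/

import Mathlib

/-- A rational `n`-tuple `φ` is an irreducible solution of `∑ cos 2πφⱼ = 0`: the sum vanishes, and
no sum over a nonempty proper subset of the indices does. -/
def IrreducibleCos {n : ℕ} (φ : Fin n → ℚ) : Prop :=
  ∑ j, Real.cos (2 * Real.pi * (φ j : ℝ)) = 0 ∧
    ∀ E : Finset (Fin n), E.Nonempty → E ≠ Finset.univ →
      ∑ j ∈ E, Real.cos (2 * Real.pi * (φ j : ℝ)) ≠ 0

/-- A rational `n`-tuple `φ` is an irreducible solution of `∑ exp (2πiφⱼ) = 0`. -/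
def IrreducibleExp {n : ℕ} (φ : Fin n → ℚ) : Prop :=
  ∑ j, Complex.exp (2 * Real.pi * Complex.I * (φ j : ℂ)) = 0 ∧
    ∀ E : Finset (Fin n), E.Nonempty → E ≠ Finset.univ →
      ∑ j ∈ E, Complex.exp (2 * Real.pi * Complex.I * (φ j : ℂ)) ≠ 0

/-- Equality of two rational numbers modulo `1`. -/
def EqModOne (x y : ℚ) : Prop := ∃ m : ℤ, x = y + m

/-- Equivalence for the exponential equation: equal up to a permutation, entries modulo `1`. -/
def ExpEquiv {n : ℕ} (φ ψ : Fin n → ℚ) : Prop :=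
  ∃ σ : Equiv.Perm (Fin n), ∀ j, EqModOne (ψ j) (φ (σ j))

/-- Equivalence for the cosine equation: `ψ` arises from `φ` (entries modulo `1`) by a permutation,
possibly the simultaneous change `φⱼ ↦ 1/2 - φⱼ` of all entries, and then changes `φⱼ ↦ 1 - φⱼ` of
any of the entries. This is the equivalence relation generated by these moves: `φⱼ ↦ 1 - φⱼ`
commutes with `φⱼ ↦ 1/2 - φⱼ` up to moves `φⱼ ↦ 1 - φⱼ` and integers. -/
def CosEquiv {n : ℕ} (φ ψ : Fin n → ℚ) : Prop :=
  ∃ σ : Equiv.Perm (Fin n),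
    (∀ j, EqModOne (ψ j) (φ (σ j)) ∨ EqModOne (ψ j) (1 - φ (σ j))) ∨
    (∀ j, EqModOne (ψ j) (1 / 2 - φ (σ j)) ∨ EqModOne (ψ j) (1 - (1 / 2 - φ (σ j))))

/-- The one-parameter families for the exponential equation. -/
def expFamilies : (n : ℕ) → List (ℚ → Fin n → ℚ)
  | 2 => [fun θ => ![θ, θ + 1 / 2]]
  | 3 => [fun θ => ![θ, θ + 1 / 3, θ + 2 / 3]]
  | 5 => [fun θ => ![θ, θ + 1 / 5, θ + 2 / 5, θ + 3 / 5, θ + 4 / 5]]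
  | 6 => [fun θ => ![θ - 1 / 6, θ + 1 / 6, θ + 1 / 5, θ + 2 / 5, θ + 3 / 5, θ + 4 / 5]]
  | _ => []

/-- The one-parameter families for the cosine equation. -/
def cosFamilies : (n : ℕ) → List (ℚ → Fin n → ℚ)
  | 2 => [fun θ => ![θ, 1 / 2 - θ]]
  | 3 => [fun θ => ![θ, θ + 1 / 3, θ - 1 / 3]]
  | 5 => [fun θ => ![θ, θ + 1 / 5, θ + 2 / 5, θ + 3 / 5, θ + 4 / 5]]
  | 6 => [fun θ => ![θ + 1 / 6, θ - 1 / 6, θ + 1 / 5, θ + 2 / 5, θ + 3 / 5, θ + 4 / 5]]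
  | _ => []

/-- The 5-tuples that depend on `L = 1, 2, 3`. -/
def cosFiveL (L : ℚ) : Fin 5 → ℚ :=
  ![L / 7 + 1 / 6, L / 7 - 1 / 6, 2 * L / 7, 3 * L / 7, 1 / 6]

/-- The first series of 6-tuples that depend on `L = 1, 2, 3`. -/
def cosSixL₁ (L : ℚ) : Fin 6 → ℚ :=
  ![L / 7 + 1 / 6, L / 7 - 1 / 6, 2 * L / 7, 3 * L / 7, 0, 1 / 3]

/-- The second series of 6-tuples that depend on `L = 1, 2, 3`. -/
def cosSixL₂ (L : ℚ) : Fin 6 → ℚ :=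
  ![L / 7 + 1 / 6, L / 7 - 1 / 6, 2 * L / 7, 3 * L / 7, 1 / 10, 3 / 10]

/-- The third series of 6-tuples that depend on `L = 1, 2, 3`. -/
def cosSixL₃ (L : ℚ) : Fin 6 → ℚ :=
  ![L / 7 + 1 / 6, L / 7 - 1 / 6, 2 * L / 7 + 1 / 6, 2 * L / 7 - 1 / 6, 3 * L / 7, 1 / 6]

/-- The sporadic solutions of the cosine equation: one triple, 4 quadruples, 7 quintuples and
13 sextuples. -/
def cosSporadic : (n : ℕ) → List (Fin n → ℚ)
  | 3 => [![1 / 10, 3 / 10, 1 / 3]]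
  | 4 => [![0, 1 / 5, 1 / 3, 2 / 5],
          ![1 / 30, 1 / 6, 11 / 30, 2 / 5],
          ![1 / 15, 4 / 15, 3 / 10, 1 / 3],
          ![1 / 7, 2 / 7, 3 / 7, 1 / 6]]
  | 5 => [![0, 1 / 30, 1 / 3, 11 / 30, 2 / 5],
          ![0, 1 / 5, 7 / 30, 1 / 3, 13 / 30],
          cosFiveL 1, cosFiveL 2, cosFiveL 3,
          ![1 / 7, 2 / 7, 3 / 7, 0, 1 / 3],
          ![1 / 7, 2 / 7, 3 / 7, 1 / 10, 3 / 10]]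
  | 6 => [![1 / 11, 2 / 11, 3 / 11, 4 / 11, 5 / 11, 1 / 6],
          cosSixL₁ 1, cosSixL₁ 2, cosSixL₁ 3,
          cosSixL₂ 1, cosSixL₂ 2, cosSixL₂ 3,
          cosSixL₃ 1, cosSixL₃ 2, cosSixL₃ 3,
          ![1 / 7, 2 / 7, 3 / 7, 0, 1 / 5, 2 / 5],
          ![1 / 7, 2 / 7, 3 / 7, 1 / 15, 4 / 15, 3 / 10],
          ![1 / 7, 2 / 7, 3 / 7, 1 / 10, 2 / 15, 7 / 15]]
  | _ => []

open Polynomial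

/-! Write e(x) for exp(2πix). A linear relation with integer coefficients among N-th roots of unity
survives when e(1/N) is replaced by any root of the cyclotomic polynomial Φ_N in a commutative ring
(`sum_zpow_eq_zero`). In ℂ this is Galois conjugation, and averaging over suitable conjugates splits
a vanishing sum with common denominator N. If p² divides N, the terms of each exponent class modulo
p vanish separately (`sum_expRat_filter_eq_zero`). If p divides N exactly once and the terms are
e(a/p + b), the partial sums of e(b) over the classes of a modulo p are all equal
(`sum_expRat_filter_eq`). In the field with 9241 elements it gives a computable necessary condition
for vanishing, which drives the finite searches and certifies that given subsums do not vanish.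

For (E), rotate so that one angle is 0 and let N be the least common denominator. Irreducibility
makes N squarefree, and for each p dividing N it makes every class modulo p nonempty, so p ≤ 6. If 5
divides N, at least four of the five equal components are single roots of unity, which leaves only
the families with five and six terms. Otherwise N divides 6 and a search finishes.

For (C), work with the 2n exponentials e(φⱼ), e(-φⱼ). Suppose that the classes modulo an odd p
vanish separately. The classes c and -c are conjugate, so for c ≠ 0 irreducibility puts every ±φⱼ
into class c for a suitable sign; the exponentials with these signs then sum to zero and (E)
applies. This settles p² dividing N, and a variant with the character modulo 4 settles 8 dividing N.
For an odd prime p dividing N exactly once, either the common component α is 0 and the same argument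
works, or all (p+1)/2 classes up to sign are occupied, so p ≤ 11. For p = 11 every class is a single
term and the solution is forced. For p = 7 one gets α = ±1, and the classes are short solutions of
simple equations. What remains has N dividing 60 and is searched.

Conversely, residues modulo 9241 show that proper subsums are nonzero, `cosInvariant` separates the
listed tuples, and in a family a cosine subsum is the real part of e(θ) times a nonzero constant, so
it vanishes for finitely many θ modulo 1. -/

/-- The root of unity `exp (2πix)` attached to a rational number. -/
noncomputable def expRat (x : ℚ) : ℂ := Complex.exp (2 * Real.pi * Complex.I * (x : ℂ))

/-- The real number `cos (2πx)` attached to a rational number. -/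
noncomputable def cosRat (x : ℚ) : ℝ := Real.cos (2 * Real.pi * (x : ℝ))

/-! ### Arithmetic of e(x) and cos 2πx at rational arguments. -/

theorem expRat_add (x y : ℚ) : expRat (x + y) = expRat x * expRat y := by
  simp only [expRat, ← Complex.exp_add]
  congr 1; push_cast; ring

theorem expRat_zero : expRat 0 = 1 := by simp [expRat]

theorem expRat_ne_zero (x : ℚ) : expRat x ≠ 0 := Complex.exp_ne_zero _

theorem expRat_mul_neg (x : ℚ) : expRat x * expRat (-x) = 1 := by
  rw [← expRat_add, add_neg_cancel, expRat_zero]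

theorem expRat_int (m : ℤ) : expRat m = 1 := by
  rw [expRat, Complex.exp_eq_one_iff]
  exact ⟨m, by push_cast; ring⟩

theorem expRat_eq_iff {x y : ℚ} : expRat x = expRat y ↔ ∃ m : ℤ, x = y + m := by
  constructor
  · intro h
    obtain ⟨m, hm⟩ := Complex.exp_eq_exp_iff_exists_int.1 h
    refine ⟨m, ?_⟩
    have h2 : (2 * Real.pi * Complex.I : ℂ) ≠ 0 := Complex.two_pi_I_ne_zero
    have : (2 * Real.pi * Complex.I : ℂ) * (x : ℂ) =
        (2 * Real.pi * Complex.I) * ((y + m : ℚ) : ℂ) := by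
      rw [hm]; push_cast; ring
    exact_mod_cast mul_left_cancel₀ h2 this
  · rintro ⟨m, rfl⟩
    rw [expRat_add, expRat_int, mul_one]

theorem expRat_add_int (x : ℚ) (m : ℤ) : expRat (x + m) = expRat x := by
  rw [expRat_add, expRat_int, mul_one]

theorem expRat_int_mul (m : ℤ) (x : ℚ) : expRat (m * x) = expRat x ^ m := by
  rw [expRat, expRat, ← Complex.exp_int_mul]
  congr 1; push_cast; ring

theorem expRat_half : expRat (1 / 2) = -1 := by
  rw [expRat, ← Complex.exp_pi_mul_I]
  congr 1; push_cast; ring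

theorem expRat_eq_exp_ofReal (x : ℚ) :
    expRat x = Complex.exp ((2 * Real.pi * (x : ℝ) : ℝ) * Complex.I) := by
  rw [expRat]; congr 1; push_cast; ring

theorem expRat_re (x : ℚ) : (expRat x).re = cosRat x := by
  rw [expRat_eq_exp_ofReal, Complex.exp_ofReal_mul_I_re, cosRat]

theorem conj_expRat (x : ℚ) : (starRingEnd ℂ) (expRat x) = expRat (-x) := by
  rw [expRat_eq_exp_ofReal, expRat_eq_exp_ofReal, ← Complex.exp_conj, map_mul, Complex.conj_ofReal,
    Complex.conj_I]
  congr 1; push_cast; ring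

theorem cosRat_neg (x : ℚ) : cosRat (-x) = cosRat x := by
  simp [cosRat]

theorem cosRat_add_int (x : ℚ) (m : ℤ) : cosRat (x + m) = cosRat x := by
  rw [← expRat_re, expRat_add_int, expRat_re]

theorem expRat_add_expRat_neg (x : ℚ) : expRat x + expRat (-x) = 2 * (cosRat x : ℂ) := by
  rw [← conj_expRat, Complex.add_conj, expRat_re]
  push_cast; rfl

theorem expRat_add_half (x : ℚ) : expRat (x + 1 / 2) = -expRat x := by
  rw [expRat_add, expRat_half, mul_neg_one]

theorem cosRat_add_half (x : ℚ) : cosRat (x + 1 / 2) = -cosRat x := by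
  rw [← expRat_re, expRat_add_half, Complex.neg_re, expRat_re]

theorem cosRat_half_sub (x : ℚ) : cosRat (1 / 2 - x) = -cosRat x := by
  rw [← cosRat_neg x, ← cosRat_add_half]; congr 1; ring

theorem cosRat_eq_iff {x y : ℚ} :
    cosRat x = cosRat y ↔ ∃ m : ℤ, x = y + m ∨ x = -y + m := by
  constructor
  · intro h
    obtain ⟨m, hm⟩ := Real.cos_eq_cos_iff.1 h.symm
    have h2 : (2 * Real.pi : ℝ) ≠ 0 := by positivity
    refine ⟨m, hm.imp (fun h => ?_) (fun h => ?_)⟩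
    · have : (2 * Real.pi : ℝ) * (x : ℝ) = (2 * Real.pi) * ((y + m : ℚ) : ℝ) := by
        rw [h]; push_cast; ring
      exact_mod_cast mul_left_cancel₀ h2 this
    · have : (2 * Real.pi : ℝ) * (x : ℝ) = (2 * Real.pi) * ((-y + m : ℚ) : ℝ) := by
        rw [h]; push_cast; ring
      exact_mod_cast mul_left_cancel₀ h2 this
  · rintro ⟨m, rfl | rfl⟩
    · rw [cosRat_add_int]
    · rw [cosRat_add_int, cosRat_neg]

/-! ### Galois conjugation and splitting of vanishing sums along p-th roots of unity. -/

theorem isPrimitiveRoot_expRat {N : ℕ} (hN : N ≠ 0) {t : ℕ} (ht : t.Coprime N) :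
    IsPrimitiveRoot (expRat (t / N)) N := by
  convert Complex.isPrimitiveRoot_exp_of_coprime t N hN ht using 1
  rw [expRat]; congr 1; push_cast; ring

theorem expRat_mul_div_zpow (t : ℕ) (N : ℕ) (k : ℤ) :
    expRat (t / N) ^ k = expRat (t * (k / N)) := by
  rw [← expRat_int_mul]; congr 1; ring

/-- A vanishing sum of `N`-th roots of unity stays a vanishing sum when the primitive root
`exp (2πi/N)` is replaced with a root of the cyclotomic polynomial in any commutative ring. -/
theorem sum_zpow_eq_zero {ι : Type*} (s : Finset ι) {N : ℕ} (hN : 0 < N) (k : ι → ℤ)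
    (h : ∑ i ∈ s, expRat (k i / N) = 0) {R : Type*} [CommRing R] (g : Rˣ)
    (hg : (cyclotomic N R).eval (g : R) = 0) : ∑ i ∈ s, ((g ^ k i : Rˣ) : R) = 0 := by
  have hN' : (N : ℤ) ≠ 0 := by exact_mod_cast hN.ne'
  have hgN : (g : R) ^ N = 1 := by
    have := eval_dvd (x := (g : R)) (cyclotomic.dvd_X_pow_sub_one N R)
    rw [hg, zero_dvd_iff] at this
    simpa [sub_eq_zero] using this
  have hgN' : g ^ N = 1 := by ext; simpa using hgN
  have hζ : IsPrimitiveRoot (expRat ((1 : ℕ) / N)) N :=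
    isPrimitiveRoot_expRat hN.ne' (Nat.coprime_one_left N)
  -- Exponents are reduced modulo N so that the relation becomes an integer polynomial vanishing at
  -- e(1/N). It is then a multiple of Φ_N, the minimal polynomial.
  set P : ℤ[X] := ∑ i ∈ s, X ^ (k i % N).toNat with hP
  have key : ∀ i, ((k i % N).toNat : ℤ) = k i % N := fun i =>
    Int.toNat_of_nonneg (Int.emod_nonneg _ hN')
  have hPζ : aeval (expRat ((1 : ℕ) / N)) P = 0 := by
    rw [hP, map_sum, ← h]
    refine Finset.sum_congr rfl fun i _ => ?_
    rw [map_pow, aeval_X, ← zpow_natCast, key, expRat_mul_div_zpow, expRat_eq_iff]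
    refine ⟨-(k i / N), ?_⟩
    have h1 : (k i : ℚ) = N * ((k i / N : ℤ) : ℚ) + ((k i % N : ℤ) : ℚ) := by
      exact_mod_cast (Int.mul_ediv_add_emod (k i) N).symm
    have h2 : (N : ℚ) ≠ 0 := by exact_mod_cast hN.ne'
    rw [h1]; push_cast; field_simp; ring
  have hdvd : cyclotomic N ℤ ∣ P := by
    rw [cyclotomic_eq_minpoly hζ hN]
    exact minpoly.isIntegrallyClosed_dvd (hζ.isIntegral hN) hPζ
  have hPg : aeval (g : R) P = 0 := by
    obtain ⟨Q, hQ⟩ := hdvd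
    rw [hQ, map_mul]
    have : aeval (g : R) (cyclotomic N ℤ) = 0 := by
      rw [← hg, ← map_cyclotomic_int N R, eval_map, aeval_def]
      rfl
    rw [this, zero_mul]
  rw [← hPg, hP, map_sum]
  refine Finset.sum_congr rfl fun i _ => ?_
  rw [map_pow, aeval_X, ← Units.val_pow_eq_pow_val]
  congr 1
  rw [← zpow_natCast, key]
  conv_lhs => rw [← Int.mul_ediv_add_emod (k i) N]
  rw [zpow_add, zpow_mul, zpow_natCast, hgN', one_zpow, one_mul]

/-- Galois conjugation of a vanishing sum of roots of unity. -/
theorem sum_expRat_mul_eq_zero {ι : Type*} (s : Finset ι) {N : ℕ} (hN : 0 < N) (x : ι → ℚ)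
    (hx : ∀ i, ∃ k : ℤ, x i * N = k) (h : ∑ i ∈ s, expRat (x i) = 0) {t : ℕ}
    (ht : t.Coprime N) : ∑ i ∈ s, expRat (t * x i) = 0 := by
  choose k hk using hx
  have h2 : (N : ℚ) ≠ 0 := by exact_mod_cast hN.ne'
  have hx : ∀ i, x i = k i / N := fun i => by rw [← hk i]; field_simp
  simp only [hx] at h ⊢
  have hp := isPrimitiveRoot_expRat hN.ne' ht
  have := sum_zpow_eq_zero s hN k h (Units.mk0 _ (expRat_ne_zero (t / N)))
    (hp.isRoot_cyclotomic hN)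
  simpa [expRat_mul_div_zpow] using this

theorem sum_range_expRat (p : ℕ) (hp : 0 < p) (d : ℤ) :
    ∑ j ∈ Finset.range p, expRat (j * (d / p)) = if (p : ℤ) ∣ d then (p : ℂ) else 0 := by
  have hp' : (p : ℚ) ≠ 0 := by exact_mod_cast hp.ne'
  have hpow : ∀ j : ℕ, expRat (j * (d / p)) = expRat (d / p) ^ j := fun j => by
    have := expRat_int_mul j (d / p)
    simpa using this
  simp only [hpow]
  split_ifs with h
  · obtain ⟨m, rfl⟩ := h
    have : expRat (((p * m : ℤ) : ℚ) / p) = 1 := by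
      rw [← expRat_int m]; congr 1; push_cast; field_simp
    simp only [this, one_pow, Finset.sum_const, Finset.card_range, nsmul_eq_mul, mul_one]
  · have h1 : expRat (d / p) ≠ 1 := by
      intro h1
      rw [← expRat_zero, expRat_eq_iff] at h1
      obtain ⟨m, hm⟩ := h1
      refine h ⟨m, ?_⟩
      field_simp at hm
      have : (d : ℚ) = p * m := by linarith
      exact_mod_cast this
    have h2 : expRat (d / p) ^ p = 1 := by
      rw [← hpow, ← expRat_int d]; congr 1; field_simp
    have h3 := mul_geom_sum (expRat (d / p)) p
    rw [h2, sub_self, mul_eq_zero, sub_eq_zero] at h3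
    exact h3.resolve_left h1

/-- If `p` divides `N / p`, then a vanishing sum of `N`-th roots of unity splits into vanishing
sums according to the exponents modulo `p`. -/
theorem sum_expRat_filter_eq_zero {ι : Type*} (s : Finset ι) {p M : ℕ} (hp : p.Prime)
    (hM : 0 < M) (hpM : p ∣ M) (x : ι → ℚ) (k : ι → ℤ) (hx : ∀ i, x i * (p * M : ℕ) = k i)
    (h : ∑ i ∈ s, expRat (x i) = 0) (c : ℤ) :
    ∑ i ∈ s with (p : ℤ) ∣ k i - c, expRat (x i) = 0 := by
  have hp0 : (p : ℚ) ≠ 0 := by exact_mod_cast hp.ne_zero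
  have hM0 : (M : ℚ) ≠ 0 := by exact_mod_cast hM.ne'
  have hpos : 0 < p * M := Nat.mul_pos hp.pos hM
  -- Because p divides M, each 1 + jM is a unit modulo pM. The corresponding conjugation multiplies
  -- the term with numerator k by e(jk/p), so averaging over j against e(-jc/p) isolates the class
  -- of c.
  have hcop : ∀ j : ℕ, (1 + j * M).Coprime (p * M) := fun j => by
    have h1 : (1 + j * M).Coprime M := by simp
    exact (h1.coprime_dvd_right hpM).mul_right h1
  have h1 : ∀ j : ℕ, ∑ i ∈ s, expRat (x i) * expRat (j * ((k i - c : ℤ) / p)) = 0 := fun j => by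
    have := sum_expRat_mul_eq_zero s hpos x (fun i => ⟨k i, hx i⟩) h (hcop j)
    rw [← zero_mul (expRat (-(j * (c / p)))), ← this, Finset.sum_mul]
    refine Finset.sum_congr rfl fun i _ => ?_
    rw [← expRat_add, ← expRat_add]
    congr 1
    have := hx i
    push_cast at this ⊢
    field_simp
    rw [← this]; ring
  have h2 : ∑ i ∈ s, expRat (x i) * (if (p : ℤ) ∣ k i - c then (p : ℂ) else 0) = 0 := by
    simp only [← sum_range_expRat p hp.pos, Finset.mul_sum]
    rw [Finset.sum_comm]
    exact Finset.sum_eq_zero fun j _ => h1 j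
  simp only [mul_ite, mul_zero, ← Finset.sum_filter, ← Finset.sum_mul] at h2
  exact (mul_eq_zero.1 h2).resolve_right (by exact_mod_cast hp.ne_zero)

/-- If `p` does not divide `M`, then the components of a vanishing sum of `pM`-th roots of unity
along the `p`-th roots of unity are all equal. -/
theorem sum_expRat_filter_eq {ι : Type*} (s : Finset ι) {p M : ℕ} (hp : p.Prime)
    (hM : 0 < M) (hpM : ¬ p ∣ M) (a : ι → ℤ) (b : ι → ℚ) (hb : ∀ i, ∃ k : ℤ, b i * M = k)
    (h : ∑ i ∈ s, expRat (a i / p + b i) = 0) (c : ℤ) :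
    (p : ℂ) * ∑ i ∈ s with (p : ℤ) ∣ a i - c, expRat (b i) = ∑ i ∈ s, expRat (b i) := by
  have hp0 : (p : ℚ) ≠ 0 := by exact_mod_cast hp.ne_zero
  have hpos : 0 < p * M := Nat.mul_pos hp.pos hM
  have hcop : p.Coprime M := (Nat.Prime.coprime_iff_not_dvd hp).2 hpM
  choose k hk using hb
  have hx : ∀ i, ∃ m : ℤ, (a i / p + b i) * (p * M : ℕ) = m := fun i => by
    refine ⟨a i * M + p * k i, ?_⟩
    push_cast
    rw [← hk i]; field_simp
  -- Conjugate by t with t ≡ j mod p and t ≡ 1 mod M: this fixes e(b) and turns e(a/p) into e(ja/p).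
  -- Only j = 0 is not a conjugation, so in the sum over all j its term, the full sum of the e(b),
  -- is the one that survives.
  have h1 : ∀ j ∈ Finset.range p, j ≠ 0 →
      ∑ i ∈ s, expRat (b i) * expRat (j * ((a i - c : ℤ) / p)) = 0 := fun j hj hj0 => by
    obtain ⟨t, ht1, ht2⟩ := Nat.chineseRemainder hcop j 1
    have htp : t.Coprime p := by
      rw [Nat.coprime_comm, Nat.Prime.coprime_iff_not_dvd hp]
      intro hd
      have : p ∣ j := (Nat.modEq_zero_iff_dvd.1 (ht1.symm.trans (Nat.modEq_zero_iff_dvd.2 hd)))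
      exact absurd (Nat.le_of_dvd (Nat.pos_of_ne_zero hj0) this) (not_le.2 (Finset.mem_range.1 hj))
    have htM : t.Coprime M := by
      rw [Nat.Coprime, ht2.gcd_eq]; simp
    have := sum_expRat_mul_eq_zero s hpos _ hx h (htp.mul_right htM)
    rw [← zero_mul (expRat (-(j * (c / p)))), ← this, Finset.sum_mul]
    refine Finset.sum_congr rfl fun i _ => ?_
    rw [← expRat_add, ← expRat_add, expRat_eq_iff]
    obtain ⟨u, hu⟩ := (Nat.modEq_iff_dvd.1 ht1)
    obtain ⟨v, hv⟩ := (Nat.modEq_iff_dvd.1 ht2)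
    refine ⟨u * a i + v * k i, ?_⟩
    have hu' : (j : ℚ) = t + p * u := by
      have : (j : ℤ) = t + p * u := by linarith
      exact_mod_cast this
    have hv' : (1 : ℚ) = t + M * v := by
      have : (1 : ℤ) = t + M * v := by push_cast at hv; linarith
      exact_mod_cast this
    have hbi : b i = t * b i + v * k i := by
      rw [← hk i]; linear_combination b i * hv'
    push_cast
    rw [hu']
    field_simp
    linear_combination p * hbi
  have h2 : ∑ i ∈ s, expRat (b i) * (if (p : ℤ) ∣ a i - c then (p : ℂ) else 0)
      = ∑ i ∈ s, expRat (b i) := by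
    simp only [← sum_range_expRat p hp.pos, Finset.mul_sum]
    rw [Finset.sum_comm, Finset.sum_eq_single_of_mem 0 (Finset.mem_range.2 hp.pos)
      (fun j hj hj0 => h1 j hj hj0)]
    simp [expRat_zero]
  rw [← h2, Finset.mul_sum, Finset.sum_filter]
  refine Finset.sum_congr rfl fun i _ => ?_
  split_ifs
  · ring
  · simp

/-- Partial fractions: a rational number with denominator dividing `pM`, where `p` and `M` are
coprime, is the sum of a fraction with denominator `p` and one with denominator `M`. -/
theorem exists_eq_div_add {p M : ℕ} (hp : 0 < p) (hM : 0 < M) (h : p.Coprime M) {x : ℚ}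
    (hx : ∃ k : ℤ, x * (p * M : ℕ) = k) :
    ∃ (a : ℤ) (b : ℚ), x = a / p + b ∧ ∃ k : ℤ, b * M = k := by
  obtain ⟨k, hk⟩ := hx
  have hp0 : (p : ℚ) ≠ 0 := by exact_mod_cast hp.ne'
  have hM0 : (M : ℚ) ≠ 0 := by exact_mod_cast hM.ne'
  have hbez : (1 : ℤ) = p * Nat.gcdA p M + M * Nat.gcdB p M := by
    rw [← Nat.gcd_eq_gcd_ab, h]; rfl
  have hbez' : (1 : ℚ) = p * (Nat.gcdA p M : ℤ) + M * (Nat.gcdB p M : ℤ) := by exact_mod_cast hbez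
  refine ⟨k * Nat.gcdB p M, k * Nat.gcdA p M / M, ?_, k * Nat.gcdA p M, ?_⟩
  · push_cast at hk ⊢
    field_simp
    rw [← hk]
    linear_combination x * p * M * hbez'
  · push_cast; field_simp

/-! ### Equivalence of tuples as equality of multisets of values. -/

theorem sum_singleton_eq_map {ι α : Type*} (s : Finset ι) (f : ι → α) :
    ∑ i ∈ s, ({f i} : Multiset α) = s.val.map f := by
  rw [← Multiset.sum_map_singleton (s.val.map f), Multiset.map_map]; rfl

/-- Equal multisets have fibres of equal size, and bijections between the fibres assemble to a
permutation. Multisets are written as sums of singletons so that a partition of the index set splits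
them by the usual lemmas on finite sums. -/
theorem exists_perm_of_sum_singleton_eq {ι α : Type*} [Fintype ι] {f g : ι → α}
    (h : ∑ i, ({f i} : Multiset α) = ∑ i, {g i}) : ∃ σ : Equiv.Perm ι, ∀ i, f i = g (σ i) := by
  classical
  rw [sum_singleton_eq_map, sum_singleton_eq_map] at h
  have key : ∀ c : α, Nonempty ({i // f i = c} ≃ {i // g i = c}) := fun c => by
    have := congrArg (Multiset.count c) h
    rw [Multiset.count_map, Multiset.count_map] at this
    refine ⟨Fintype.equivOfCardEq ?_⟩
    rw [Fintype.card_subtype, Fintype.card_subtype]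
    simpa [Finset.card_def, Finset.filter_val, eq_comm] using this
  exact ⟨Equiv.ofFiberEquiv fun c => (key c).some, fun i => (Equiv.ofFiberEquiv_map _ i).symm⟩

theorem sum_singleton_comp_perm {ι α : Type*} [Fintype ι] (σ : Equiv.Perm ι) (g : ι → α) :
    ∑ i, ({g (σ i)} : Multiset α) = ∑ i, {g i} :=
  Equiv.sum_comp σ fun i => ({g i} : Multiset α)

/-- The multiset of the numbers `cos (2πφⱼ)`. -/
noncomputable def cosMultiset {n : ℕ} (φ : Fin n → ℚ) : Multiset ℝ := ∑ j, {cosRat (φ j)}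

/-- The multiset of the numbers `exp (2πiφⱼ)`. -/
noncomputable def expMultiset {n : ℕ} (φ : Fin n → ℚ) : Multiset ℂ := ∑ j, {expRat (φ j)}

theorem cosMultiset_neg {n : ℕ} (φ : Fin n → ℚ) :
    cosMultiset (fun j => 1 / 2 - φ j) = (cosMultiset φ).map (-·) := by
  simp only [cosMultiset, sum_singleton_eq_map, Multiset.map_map, Function.comp_def,
    cosRat_half_sub]

theorem cosMultiset_eq_map_re {n : ℕ} (φ : Fin n → ℚ) :
    cosMultiset φ = (expMultiset φ).map Complex.re := by
  simp only [cosMultiset, expMultiset, sum_singleton_eq_map, Multiset.map_map, Function.comp_def,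
    expRat_re]

theorem cosRat_eq_iff_eqModOne {x y : ℚ} :
    cosRat x = cosRat y ↔ EqModOne x y ∨ EqModOne x (1 - y) := by
  rw [cosRat_eq_iff]
  constructor
  · rintro ⟨m, h | h⟩
    · exact Or.inl ⟨m, h⟩
    · exact Or.inr ⟨m - 1, by rw [h]; push_cast; ring⟩
  · rintro (⟨m, h⟩ | ⟨m, h⟩)
    · exact ⟨m, Or.inl h⟩
    · exact ⟨m + 1, Or.inr (by rw [h]; push_cast; ring)⟩

/-- The cosine forgets exactly integers and signs, and the simultaneous change to 1/2 - φⱼ negates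
all cosines. -/
theorem cosEquiv_iff {n : ℕ} {φ ψ : Fin n → ℚ} :
    CosEquiv φ ψ ↔ cosMultiset ψ = cosMultiset φ ∨ cosMultiset ψ = (cosMultiset φ).map (-·) := by
  rw [← cosMultiset_neg]
  constructor
  · rintro ⟨σ, h | h⟩
    · left
      simp only [cosMultiset, fun j => cosRat_eq_iff_eqModOne.2 (h j)]
      exact sum_singleton_comp_perm σ fun j => cosRat (φ j)
    · right
      simp only [cosMultiset, fun j => cosRat_eq_iff_eqModOne.2 (h j)]
      exact sum_singleton_comp_perm σ fun j => cosRat (1 / 2 - φ j)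
  · rintro (h | h)
    · obtain ⟨σ, hσ⟩ := exists_perm_of_sum_singleton_eq h
      exact ⟨σ, Or.inl fun j => cosRat_eq_iff_eqModOne.1 (hσ j)⟩
    · obtain ⟨σ, hσ⟩ := exists_perm_of_sum_singleton_eq h
      exact ⟨σ, Or.inr fun j => cosRat_eq_iff_eqModOne.1 (hσ j)⟩

theorem expEquiv_iff {n : ℕ} {φ ψ : Fin n → ℚ} :
    ExpEquiv φ ψ ↔ expMultiset ψ = expMultiset φ := by
  constructor
  · rintro ⟨σ, h⟩
    simp only [expMultiset, fun j => expRat_eq_iff.2 (h j)]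
    exact sum_singleton_comp_perm σ fun j => expRat (φ j)
  · intro h
    obtain ⟨σ, hσ⟩ := exists_perm_of_sum_singleton_eq h
    exact ⟨σ, fun j => expRat_eq_iff.1 (hσ j)⟩

theorem IrreducibleCos.sum_eq_zero {n : ℕ} {φ : Fin n → ℚ} (h : IrreducibleCos φ) :
    ∑ j, cosRat (φ j) = 0 := h.1

theorem IrreducibleCos.eq_univ {n : ℕ} {φ : Fin n → ℚ} (h : IrreducibleCos φ)
    {E : Finset (Fin n)} (hE : E.Nonempty) (h0 : ∑ j ∈ E, cosRat (φ j) = 0) : E = Finset.univ :=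
  by_contra fun hne => h.2 E hE hne h0

theorem IrreducibleExp.sum_eq_zero {n : ℕ} {φ : Fin n → ℚ} (h : IrreducibleExp φ) :
    ∑ j, expRat (φ j) = 0 := h.1

theorem IrreducibleExp.eq_univ {n : ℕ} {φ : Fin n → ℚ} (h : IrreducibleExp φ)
    {E : Finset (Fin n)} (hE : E.Nonempty) (h0 : ∑ j ∈ E, expRat (φ j) = 0) : E = Finset.univ :=
  by_contra fun hne => h.2 E hE hne h0

theorem IrreducibleCos.congr {n : ℕ} {φ ψ : Fin n → ℚ} (h : IrreducibleCos φ)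
    (hψ : ∀ j, cosRat (ψ j) = cosRat (φ j)) : IrreducibleCos ψ := by
  change ∑ j, cosRat (ψ j) = 0 ∧ ∀ E : Finset (Fin n), E.Nonempty → E ≠ Finset.univ →
    ∑ j ∈ E, cosRat (ψ j) ≠ 0
  simp only [hψ]
  exact h

theorem IrreducibleCos.neg {n : ℕ} {φ ψ : Fin n → ℚ} (h : IrreducibleCos φ)
    (hψ : ∀ j, cosRat (ψ j) = -cosRat (φ j)) : IrreducibleCos ψ := by
  change ∑ j, cosRat (ψ j) = 0 ∧ ∀ E : Finset (Fin n), E.Nonempty → E ≠ Finset.univ →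
    ∑ j ∈ E, cosRat (ψ j) ≠ 0
  simp only [hψ, Finset.sum_neg_distrib, neg_eq_zero, ne_eq]
  exact h

theorem IrreducibleExp.of_mul {n : ℕ} {φ ψ : Fin n → ℚ} (h : IrreducibleExp φ) {z : ℂ}
    (hz : z ≠ 0) (hψ : ∀ j, expRat (ψ j) = z * expRat (φ j)) : IrreducibleExp ψ := by
  change ∑ j, expRat (ψ j) = 0 ∧ ∀ E : Finset (Fin n), E.Nonempty → E ≠ Finset.univ →
    ∑ j ∈ E, expRat (ψ j) ≠ 0
  simp only [hψ, ← Finset.mul_sum]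
  exact ⟨by rw [h.sum_eq_zero, mul_zero], fun E h1 h2 => mul_ne_zero hz (h.2 E h1 h2)⟩

theorem IrreducibleExp.of_multiset_eq {n : ℕ} {φ ψ : Fin n → ℚ} (h : IrreducibleExp φ)
    (hψ : expMultiset ψ = expMultiset φ) : IrreducibleExp ψ := by
  obtain ⟨σ, hσ⟩ := exists_perm_of_sum_singleton_eq hψ
  change ∑ j, expRat (ψ j) = 0 ∧ ∀ E : Finset (Fin n), E.Nonempty → E ≠ Finset.univ →
    ∑ j ∈ E, expRat (ψ j) ≠ 0
  simp only [hσ]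
  refine ⟨by rw [Equiv.sum_comp σ fun j => expRat (φ j)]; exact h.1, fun E h1 h2 h3 => ?_⟩
  refine h.2 (E.map σ.toEmbedding) (h1.map) (fun h4 => h2 ?_) ?_
  · rw [← Finset.card_eq_iff_eq_univ] at h4 ⊢
    simpa using h4
  · rw [Finset.sum_map]; exact h3

/-- The tuple is, up to equivalence, sporadic or a member of a family. -/
def IsListedCos {n : ℕ} (φ : Fin n → ℚ) : Prop :=
  ∃ ψ : Fin n → ℚ, (ψ ∈ cosSporadic n ∨ ∃ F ∈ cosFamilies n, ∃ θ : ℚ, ψ = F θ) ∧ CosEquiv ψ φ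

/-- The tuple is, up to equivalence, a member of a family. -/
def IsListedExp {n : ℕ} (φ : Fin n → ℚ) : Prop :=
  ∃ F ∈ expFamilies n, ∃ θ : ℚ, ExpEquiv (F θ) φ

theorem IsListedCos.congr {n : ℕ} {φ φ' : Fin n → ℚ} (h : IsListedCos φ')
    (hφ : ∀ j, cosRat (φ' j) = cosRat (φ j)) : IsListedCos φ := by
  obtain ⟨ψ, hψ, h⟩ := h
  have h1 : cosMultiset φ' = cosMultiset φ := by simp only [cosMultiset, hφ]
  exact ⟨ψ, hψ, cosEquiv_iff.2 (h1 ▸ cosEquiv_iff.1 h)⟩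

theorem IsListedCos.neg {n : ℕ} {φ φ' : Fin n → ℚ} (h : IsListedCos φ')
    (hφ : ∀ j, cosRat (φ' j) = -cosRat (φ j)) : IsListedCos φ := by
  obtain ⟨ψ, hψ, h⟩ := h
  have h1 : cosMultiset φ = (cosMultiset φ').map (-·) := by
    rw [← cosMultiset_neg]
    simp only [cosMultiset, cosRat_half_sub, hφ, neg_neg]
  refine ⟨ψ, hψ, cosEquiv_iff.2 ?_⟩
  rw [h1]
  rcases cosEquiv_iff.1 h with h | h
  · right; rw [h]
  · left; rw [h, Multiset.map_map]; simp

/-- Real parts carry each exponential family to the cosine family with the same number of terms, up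
to reordering, integers and signs. -/
theorem IsListedExp.isListedCos {n : ℕ} (hn : n ≤ 6) {φ : Fin n → ℚ} (h : IsListedExp φ) :
    IsListedCos φ := by
  obtain ⟨F, hF, θ, h⟩ := h
  have h : cosMultiset φ = cosMultiset (F θ) := by
    rw [cosMultiset_eq_map_re, cosMultiset_eq_map_re, expEquiv_iff.1 h]
  suffices h' : ∃ G ∈ cosFamilies n, cosMultiset (F θ) = cosMultiset (G θ) by
    obtain ⟨G, hG, h'⟩ := h'
    exact ⟨_, Or.inr ⟨G, hG, θ, rfl⟩, cosEquiv_iff.2 (Or.inl (h.trans h'))⟩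
  interval_cases n
  · simp [expFamilies] at hF
  · simp [expFamilies] at hF
  · simp only [expFamilies, List.mem_singleton] at hF
    subst hF
    refine ⟨_, List.mem_singleton_self _, ?_⟩
    have : cosRat (θ + 1 / 2) = cosRat (1 / 2 - θ) := by
      rw [cosRat_add_half, cosRat_half_sub]
    simp only [cosMultiset, Fin.sum_univ_two, Matrix.cons_val_zero, Matrix.cons_val_one, this]
  · simp only [expFamilies, List.mem_singleton] at hF
    subst hF
    refine ⟨_, List.mem_singleton_self _, ?_⟩
    have : cosRat (θ + 2 / 3) = cosRat (θ - 1 / 3) := by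
      rw [← cosRat_add_int (θ - 1 / 3) 1]; congr 1; push_cast; ring
    simp [cosMultiset, Fin.sum_univ_succ, this]
  · simp [expFamilies] at hF
  · simp only [expFamilies, List.mem_singleton] at hF
    subst hF
    exact ⟨_, List.mem_singleton_self _, rfl⟩
  · simp only [expFamilies, List.mem_singleton] at hF
    subst hF
    refine ⟨_, List.mem_singleton_self _, ?_⟩
    simp only [cosMultiset, Fin.sum_univ_succ, Matrix.cons_val_zero, Matrix.cons_val_succ]
    exact add_left_comm _ _ _

theorem IsListedCos.cosEquiv {n : ℕ} {φ : Fin n → ℚ} (h : IsListedCos φ) :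
    (∃ ψ ∈ cosSporadic n, CosEquiv ψ φ) ∨ (∃ F ∈ cosFamilies n, ∃ θ : ℚ, CosEquiv (F θ) φ) := by
  obtain ⟨ψ, hψ | ⟨F, hF, θ, rfl⟩, h⟩ := h
  · exact Or.inl ⟨ψ, hψ, h⟩
  · exact Or.inr ⟨F, hF, θ, h⟩

/-- The least common denominator of a tuple. -/
theorem exists_minimal_denominator {ι : Type*} [Fintype ι] (φ : ι → ℚ) :
    ∃ N : ℕ, 0 < N ∧ (∀ i, ∃ k : ℤ, φ i * N = k) ∧
      ∀ M : ℕ, 0 < M → M < N → ¬ ∀ i, ∃ k : ℤ, φ i * M = k := by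
  classical
  have hex : ∃ N : ℕ, 0 < N ∧ ∀ i, ∃ k : ℤ, φ i * N = k := by
    refine ⟨∏ i, (φ i).den, Finset.prod_pos fun i _ => (φ i).pos, fun i => ?_⟩
    obtain ⟨m, hm⟩ := Finset.dvd_prod_of_mem (fun i => (φ i).den) (Finset.mem_univ i)
    refine ⟨(φ i).num * m, ?_⟩
    rw [hm]; push_cast
    rw [← mul_assoc, Rat.mul_den_eq_num]
  refine ⟨Nat.find hex, (Nat.find_spec hex).1, (Nat.find_spec hex).2, fun M hM hlt h => ?_⟩
  exact Nat.find_min hex hlt ⟨hM, h⟩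

/-! ### Reduction modulo a prime above 9241. -/

/-- 4620 = 4·3·5·7·11 is a common denominator for all the finite computations, and the prime 9241 =
2·4620 + 1 splits completely in the corresponding cyclotomic field. The root is 169 = 13²; its order
is certified by the powers 4620/q for the primes q dividing 4620. -/
theorem isPrimitiveRoot_zmod : IsPrimitiveRoot (169 : ZMod 9241) 4620 := by
  have hpow : ∀ n : ℕ, (169 : ZMod 9241) ^ n = 1 ↔ 169 ^ n % 9241 = 1 := fun n => by
    have : ((169 ^ n : ℕ) : ZMod 9241) = ((1 : ℕ) : ZMod 9241) ↔ 169 ^ n % 9241 = 1 % 9241 :=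
      ZMod.natCast_eq_natCast_iff' _ _ _
    simpa using this
  have h : orderOf (169 : ZMod 9241) = 4620 := by
    refine orderOf_eq_of_pow_and_pow_div_prime (by norm_num) ((hpow _).2 (by decide +kernel)) ?_
    intro p hp hd
    rw [Ne, hpow]
    rw [show 4620 = 2 * 2 * 3 * 5 * 7 * 11 by norm_num, hp.dvd_mul, hp.dvd_mul, hp.dvd_mul,
      hp.dvd_mul, hp.dvd_mul, Nat.prime_dvd_prime_iff_eq hp (by norm_num),
      Nat.prime_dvd_prime_iff_eq hp (by norm_num), Nat.prime_dvd_prime_iff_eq hp (by norm_num),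
      Nat.prime_dvd_prime_iff_eq hp (by norm_num),
      Nat.prime_dvd_prime_iff_eq hp (by norm_num)] at hd
    rcases hd with ((((((rfl | rfl) | rfl) | rfl) | rfl) | rfl)) <;> decide +kernel
  exact h ▸ IsPrimitiveRoot.orderOf _

/-- The value of the root of unity `exp (2πi k/4620)` modulo a prime above `9241`. -/
def expResidue (k : ℤ) : ℕ := 169 ^ (k % 4620).toNat % 9241

/-- The value of `2 cos (2π k/4620)` modulo a prime above `9241`. -/
def cosResidue (k : ℤ) : ℕ := (expResidue k + expResidue (-k)) % 9241

/-- This is `sum_zpow_eq_zero` in `ZMod 9241`. Only this direction is needed: a zero residue is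
necessary for vanishing, and a nonzero residue disproves it. -/
theorem sum_expResidue_mod {ι : Type*} (s : Finset ι) (k : ι → ℤ)
    (h : ∑ i ∈ s, expRat (k i / 4620) = 0) : (∑ i ∈ s, expResidue (k i)) % 9241 = 0 := by
  have : Fact (Nat.Prime 9241) := ⟨by norm_num⟩
  have hu := isPrimitiveRoot_zmod
  set g : (ZMod 9241)ˣ := Units.mk0 169 (hu.ne_zero (by norm_num)) with hg
  have hgN : g ^ 4620 = 1 := by
    ext; rw [Units.val_pow_eq_pow_val]; exact hu.pow_eq_one
  have := sum_zpow_eq_zero s (N := 4620) (by norm_num) k (by exact_mod_cast h) g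
    (hu.isRoot_cyclotomic (by norm_num))
  rw [← Nat.dvd_iff_mod_eq_zero, ← ZMod.natCast_eq_zero_iff, ← this, Nat.cast_sum]
  refine Finset.sum_congr rfl fun i _ => ?_
  rw [expResidue, ZMod.natCast_mod]
  conv_rhs => rw [← Int.mul_ediv_add_emod (k i) 4620, zpow_add, zpow_mul]
  rw [show g ^ (4620 : ℤ) = 1 by exact_mod_cast hgN, one_zpow, one_mul]
  conv_rhs => rw [← Int.toNat_of_nonneg (Int.emod_nonneg (k i) (by norm_num : (4620 : ℤ) ≠ 0))]
  rw [zpow_natCast, Units.val_pow_eq_pow_val, hg, Units.val_mk0, Nat.cast_pow]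
  rfl

theorem sum_cosResidue_mod {ι : Type*} (s : Finset ι) (k : ι → ℤ)
    (h : ∑ i ∈ s, cosRat (k i / 4620) = 0) : (∑ i ∈ s, cosResidue (k i)) % 9241 = 0 := by
  have h1 : ∑ i ∈ s.disjSum s, expRat ((Sum.elim k (-k) i : ℤ) / 4620) = 0 := by
    rw [Finset.sum_disjSum, ← Finset.sum_add_distrib]
    have : ∀ i, expRat ((Sum.elim k (-k) (Sum.inl i) : ℤ) / 4620) +
        expRat ((Sum.elim k (-k) (Sum.inr i) : ℤ) / 4620) = 2 * (cosRat (k i / 4620) : ℂ) :=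
      fun i => by
        rw [← expRat_add_expRat_neg]
        simp [neg_div]
    simp only [this, ← Finset.mul_sum, ← Complex.ofReal_sum, h]
    simp
  have h2 := sum_expResidue_mod _ _ h1
  rw [Finset.sum_disjSum, ← Finset.sum_add_distrib] at h2
  simp only [cosResidue]
  rw [← Finset.sum_nat_mod]
  exact h2

/-! ### Exhaustive search over multisets, checked by the kernel. -/

/-- Run through the multisets of `n` elements of `vs`, each extended by `acc`, and test whether
those whose sum (of the second components, increased by `s`) vanishes modulo `q` satisfy `good`. -/
def checkSums (q : ℕ) (good : List ℕ → Bool) : ℕ → List (ℕ × ℕ) → ℕ → List ℕ → Bool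
  | 0, _, s, acc => !(Nat.beq (s % q) 0) || good acc
  | n + 1, vs, s, acc => vs.tails.all fun t => match t with
    | [] => true
    | v :: t => checkSums q good n (v :: t) (s + v.2) (v.1 :: acc)

/-- Soundness of the search. If the head of `vs` occurs in `m`, remove one copy and keep the head
available for repetitions; otherwise discard the head. Each multiset is thus met in the order of
`vs`, and the list `l` is the one on which `good` was evaluated. -/
theorem exists_good_of_checkSums {q : ℕ} {good : List ℕ → Bool} (r : ℕ → ℕ) (n : ℕ) :
    ∀ (vs : List (ℕ × ℕ)) (s : ℕ) (acc : List ℕ), (∀ v ∈ vs, v.2 = r v.1) →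
      checkSums q good n vs s acc = true → ∀ m : Multiset ℕ, m.card = n →
      (∀ x ∈ m, x ∈ vs.map Prod.fst) → (s + (m.map r).sum) % q = 0 →
      ∃ l : List ℕ, (l : Multiset ℕ) = m + acc ∧ good l = true := by
  induction n with
  | zero =>
    intro vs s acc _ hc m hm _ hsum
    rw [Multiset.card_eq_zero] at hm
    subst hm
    refine ⟨acc, by simp, ?_⟩
    simp only [Multiset.map_zero, Multiset.sum_zero, add_zero] at hsum
    simpa [checkSums, hsum] using hc
  | succ n ih =>
    intro vs s acc hvs hc m hm hmem hsum
    induction vs with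
    | nil =>
      obtain ⟨x, hx⟩ := Multiset.card_pos_iff_exists_mem.1 (by omega : 0 < m.card)
      simpa using hmem x hx
    | cons v vs ihv =>
      rw [checkSums, List.tails_cons, List.all_cons, Bool.and_eq_true] at hc
      by_cases hv : v.1 ∈ m
      · obtain ⟨m', rfl⟩ := Multiset.exists_cons_of_mem hv
        obtain ⟨l, hl, hg⟩ := ih (v :: vs) (s + v.2) (v.1 :: acc) hvs hc.1 m' (by simpa using hm)
          (fun x hx => hmem x (Multiset.mem_cons_of_mem hx)) (by
            rw [Multiset.map_cons, Multiset.sum_cons] at hsum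
            rw [hvs v (by simp), add_assoc]; exact hsum)
        refine ⟨l, ?_, hg⟩
        rw [hl, ← Multiset.cons_coe, Multiset.add_cons, Multiset.cons_add]
      · refine ihv (fun w hw => hvs w (List.mem_cons_of_mem _ hw)) hc.2 fun x hx => ?_
        have := hmem x hx
        rw [List.map_cons, List.mem_cons] at this
        exact this.resolve_left fun h => hv (h ▸ hx)

/-- Turns a submultiset found by a search into a set of indices, to which irreducibility can be
applied. -/
theorem exists_finset_of_le_sum_singleton {ι α : Type*} [Fintype ι] (f : ι → α) {b : Multiset α}
    (h : b ≤ ∑ i, {f i}) : ∃ E : Finset ι, ∑ i ∈ E, {f i} = b := by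
  classical
  suffices H : ∀ (s : Multiset ι) (b : Multiset α), b ≤ s.map f → ∃ t ≤ s, t.map f = b by
    rw [sum_singleton_eq_map] at h
    obtain ⟨t, ht, rfl⟩ := H _ _ h
    exact ⟨⟨t, Multiset.nodup_of_le ht Finset.univ.nodup⟩, sum_singleton_eq_map _ _⟩
  intro s
  induction s using Multiset.induction_on with
  | empty => intro b hb; exact ⟨0, le_rfl, (Multiset.le_zero.1 (by simpa using hb)).symm⟩
  | cons a s ih =>
    intro b hb
    rw [Multiset.map_cons] at hb
    by_cases hab : f a ∈ b
    · obtain ⟨b', rfl⟩ := Multiset.exists_cons_of_mem hab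
      obtain ⟨t, ht, rfl⟩ := ih b' ((Multiset.cons_le_cons_iff _).1 hb)
      exact ⟨a ::ₘ t, (Multiset.cons_le_cons_iff _).2 ht, Multiset.map_cons _ _ _⟩
    · obtain ⟨t, ht, rfl⟩ := ih b ((Multiset.le_cons_of_notMem hab).1 hb)
      exact ⟨t, ht.trans (Multiset.le_cons_self _ _), rfl⟩

/-- Whether the list `b` is contained in the list `l`, multiplicities counted. -/
def isSubmultiset (b l : List ℕ) : Bool := b.all fun x => Nat.ble (b.count x) (l.count x)

theorem coe_le_of_isSubmultiset {b l : List ℕ} (h : isSubmultiset b l = true) :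
    (b : Multiset ℕ) ≤ (l : Multiset ℕ) := by
  rw [Multiset.le_iff_count]
  intro x
  simp only [isSubmultiset, List.all_eq_true, Nat.ble_eq] at h
  by_cases hx : x ∈ b
  · simpa using h x hx
  · simp [List.count_eq_zero_of_not_mem hx]

/-! ### Cosine solutions with denominator 60. -/

/-- The angles `2πk/60` with `k` even, up to sign, and the residues of twice their cosines. -/
def evenResidues : List (ℕ × ℕ) :=
  [(0, 2), (2, 8986), (4, 336), (6, 6985), (8, 2002), (10, 1), (12, 6984), (14, 2592), (16,
   6649), (18, 2257), (20, 9240), (22, 7239), (24, 2256), (26, 8905), (28, 255), (30, 9239)]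

/-- The angles `2πk/60` with `k` odd, up to sign, and the residues of twice their cosines. -/
def oddResidues : List (ℕ × ℕ) :=
  [(1, 7382), (3, 4613), (5, 8392), (7, 8580), (9, 3066), (11, 4316), (13, 5274), (15, 0), (17,
   3967), (19, 4925), (21, 6175), (23, 661), (25, 849), (27, 4628), (29, 1859)]

/-- The numerator of the representative in `[0, 1/2]` of `k/60` modulo `1` and sign. -/
def foldSixty (k : ℕ) : ℕ := min (k % 60) (60 - k % 60)

/-- Numerators over `60` of irreducible solutions of the cosine equation with at most 3 terms. -/
def shortSolutions : List (List ℕ) :=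
  [15] :: [6, 18, 20] :: [24, 12, 10] :: ((List.range 16).map fun k => [k, 30 - k]) ++
    (List.range 20).map fun k => [k, k + 20, k + 40].map foldSixty

/-- The sporadic solutions of the cosine equation with denominator `60`, by their numerators. -/
def sporadicSixty : List (List ℕ) :=
  [[6, 18, 20], [0, 12, 20, 24], [2, 10, 22, 24], [4, 16, 18, 20], [0, 2, 20, 22, 24],
    [0, 12, 14, 20, 26]]

/-- The families of solutions of the cosine equation, by the numerators of the shifts. -/
def familyShifts : List (List ℕ) :=
  [[0, 30], [0, 20, 40], [0, 12, 24, 36, 48], [10, 50, 12, 24, 36, 48]]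

/-- The list contains a proper short solution, or is a sporadic solution or a member of a family. -/
def isReducibleOrListed (l : List ℕ) : Bool :=
  -- The strict inequality of lengths makes the vanishing part proper, which contradicts
  -- irreducibility.
  (shortSolutions.any fun b => Nat.blt b.length l.length && isSubmultiset b l) ||
  (sporadicSixty.any fun a => l.isPerm a || l.isPerm (a.map fun x => 30 - x)) ||
  familyShifts.any fun s => (List.range 60).any fun t => l.isPerm (s.map fun x => foldSixty (t + x))


/-- The lengths tested are 2 to 6. A reducible solution of at most six terms has a vanishing part
with at most three terms, which is why `shortSolutions` stops there. Treating even and odd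
numerators separately keeps the search small; that no solution mixing them is missed follows from
`IrreducibleCos.odd_of_four_dvd`. -/
theorem checkSums_evenResidues :
    ((List.range 5).all fun n =>
      checkSums 9241 isReducibleOrListed (n + 2) evenResidues 0 []) = true := by
  decide +kernel

theorem checkSums_oddResidues :
    ((List.range 5).all fun n =>
      checkSums 9241 isReducibleOrListed (n + 2) oddResidues 0 []) = true := by
  decide +kernel

theorem foldSixty_le (k : ℕ) : foldSixty k ≤ 30 := by
  unfold foldSixty; omega

theorem cosRat_foldSixty (k : ℕ) : cosRat (foldSixty k / 60) = cosRat (k / 60) := by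
  have h1 : (k : ℚ) = 60 * (k / 60 : ℕ) + (k % 60 : ℕ) := by
    exact_mod_cast (Nat.div_add_mod k 60).symm
  have h2 : k % 60 < 60 := Nat.mod_lt _ (by norm_num)
  rw [cosRat_eq_iff]
  unfold foldSixty
  generalize k / 60 = d at h1
  generalize k % 60 = e at h1 h2 ⊢
  rcases le_total e (60 - e) with h | h
  · exact ⟨-d, Or.inl (by rw [min_eq_left h, h1]; push_cast; ring)⟩
  · exact ⟨d + 1, Or.inr (by rw [min_eq_right h, Nat.cast_sub h2.le, h1]; push_cast; ring)⟩

theorem exists_foldSixty (K : ℤ) : cosRat (foldSixty (K % 60).toNat / 60) = cosRat (K / 60) := by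
  rw [cosRat_foldSixty]
  have h1 : (K : ℚ) = 60 * (K / 60 : ℤ) + (K % 60 : ℤ) := by
    exact_mod_cast (Int.mul_ediv_add_emod K 60).symm
  have h2 : (((K % 60).toNat : ℤ) : ℚ) = (K % 60 : ℤ) := by
    rw [Int.toNat_of_nonneg (Int.emod_nonneg _ (by norm_num))]
  rw [cosRat_eq_iff]
  refine ⟨-(K / 60), Or.inl ?_⟩
  rw [h1, ← h2]; push_cast; ring

theorem cosRat_zero : cosRat 0 = 1 := by simp [cosRat]

theorem cosRat_quarter : cosRat (1 / 4) = 0 := by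
  have := cosRat_half_sub (1 / 4)
  norm_num at this
  linarith

theorem sum_range_expRat_add_div {p : ℕ} (hp : 1 < p) (θ : ℚ) :
    ∑ j ∈ Finset.range p, expRat (θ + j / p) = 0 := by
  have h1 := sum_range_expRat p (by omega) 1
  have h2 : ¬ (p : ℤ) ∣ 1 := fun h => by
    have := Int.eq_one_of_dvd_one (by omega) h
    omega
  rw [if_neg h2] at h1
  simp only [expRat_add, ← Finset.mul_sum]
  rw [mul_eq_zero]; right
  rw [← h1]
  refine Finset.sum_congr rfl fun j _ => ?_
  congr 1; push_cast; ring

theorem sum_range_cosRat (p : ℕ) (hp : 1 < p) (x : ℚ) :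
    ∑ j ∈ Finset.range p, cosRat (x + j / p) = 0 := by
  have := congrArg Complex.re (sum_range_expRat_add_div hp x)
  simpa only [Complex.re_sum, expRat_re, Complex.zero_re] using this

theorem cosRat_third_shift (x : ℚ) :
    cosRat x + cosRat (x + 1 / 3) + cosRat (x + 2 / 3) = 0 := by
  have := sum_range_cosRat 3 (by norm_num) x
  simpa [Finset.sum_range_succ] using this

theorem cosRat_fifth_shift (x : ℚ) :
    cosRat x + cosRat (x + 1 / 5) + cosRat (x + 2 / 5) + cosRat (x + 3 / 5) +
      cosRat (x + 4 / 5) = 0 := by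
  have := sum_range_cosRat 5 (by norm_num) x
  simpa [Finset.sum_range_succ] using this

theorem cosRat_third : cosRat (1 / 3) = -1 / 2 := by
  have h1 := cosRat_third_shift 0
  have h2 : cosRat (2 / 3) = cosRat (1 / 3) := by
    rw [← cosRat_neg, ← cosRat_add_int (-(2 / 3)) 1]; norm_num
  rw [cosRat_zero, zero_add, zero_add, h2] at h1
  linarith

theorem cosRat_sixth : cosRat (1 / 6) = 1 / 2 := by
  have := cosRat_half_sub (1 / 3)
  rw [cosRat_third] at this
  norm_num at this ⊢
  exact this

theorem cosRat_fifths : cosRat (1 / 5) + cosRat (2 / 5) = -1 / 2 := by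
  have h1 := cosRat_fifth_shift 0
  have h2 : cosRat (4 / 5) = cosRat (1 / 5) := by
    rw [← cosRat_neg, ← cosRat_add_int (-(4 / 5)) 1]; norm_num
  have h3 : cosRat (3 / 5) = cosRat (2 / 5) := by
    rw [← cosRat_neg, ← cosRat_add_int (-(3 / 5)) 1]; norm_num
  simp only [cosRat_zero, zero_add, h2, h3] at h1
  linarith

theorem cosRat_tenths : cosRat (1 / 10) + cosRat (3 / 10) = 1 / 2 := by
  have h1 := cosRat_half_sub (1 / 5)
  have h2 := cosRat_half_sub (2 / 5)
  have := cosRat_fifths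
  norm_num at h1 h2
  rw [h1, h2]; norm_num at *; linarith

theorem sum_shortSolutions {b : List ℕ} (hb : b ∈ shortSolutions) :
    (b.map fun k : ℕ => cosRat (k / 60)).sum = 0 := by
  simp only [shortSolutions, List.mem_cons, List.mem_append, List.mem_map, List.mem_range,
    List.cons_append] at hb
  rcases hb with rfl | rfl | rfl | ⟨k, hk, rfl⟩ | ⟨k, -, rfl⟩
  · have := cosRat_quarter
    norm_num at this ⊢; exact this
  · have h1 := cosRat_tenths
    have h2 := cosRat_third
    norm_num at h1 h2 ⊢; linarith
  · have h1 := cosRat_fifths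
    have h2 := cosRat_sixth
    norm_num at h1 h2 ⊢; linarith
  · have : (((30 - k : ℕ) : ℚ) / 60) = 1 / 2 - k / 60 := by
      rw [Nat.cast_sub (by omega)]; ring
    simp only [List.map_cons, List.map_nil, List.sum_cons, List.sum_nil, this, cosRat_half_sub]
    ring
  · have := cosRat_third_shift (k / 60)
    simp only [List.map_cons, List.map_nil, List.sum_cons, List.sum_nil, cosRat_foldSixty]
    have h1 : (((k + 20 : ℕ) : ℚ) / 60) = k / 60 + 1 / 3 := by push_cast; ring
    have h2 : (((k + 40 : ℕ) : ℚ) / 60) = k / 60 + 2 / 3 := by push_cast; ring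
    rw [h1, h2]; linarith

theorem map_sum_singleton {ι α β : Type*} (s : Finset ι) (k : ι → α) (f : α → β) :
    (∑ i ∈ s, ({k i} : Multiset α)).map f = ∑ i ∈ s, {f (k i)} := by
  simp only [sum_singleton_eq_map, Multiset.map_map, Function.comp_def]

theorem sum_sum_singleton {ι : Type*} (s : Finset ι) (f : ι → ℝ) :
    (∑ i ∈ s, ({f i} : Multiset ℝ)).sum = ∑ i ∈ s, f i := by
  rw [sum_singleton_eq_map]; rfl

/-- An indexed family of angles that contains a short solution has a vanishing subsum. -/
theorem exists_sum_eq_zero_of_shortSolution {ι : Type*} [Fintype ι] {φ : ι → ℚ} {k : ι → ℕ}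
    (hk : ∀ j, cosRat (φ j) = cosRat (k j / 60)) {l b : List ℕ}
    (hl : (l : Multiset ℕ) = ∑ j, {k j}) (hb : b ∈ shortSolutions)
    (h : isSubmultiset b l = true) :
    ∃ E : Finset ι, E.card = b.length ∧ E.Nonempty ∧ ∑ j ∈ E, cosRat (φ j) = 0 := by
  have hle := coe_le_of_isSubmultiset h
  rw [hl] at hle
  obtain ⟨E, hE⟩ := exists_finset_of_le_sum_singleton k hle
  have hcard : E.card = b.length := by
    have := congrArg Multiset.card hE
    simpa using this
  have hpos : ∀ b ∈ shortSolutions, 0 < b.length := by decide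
  refine ⟨E, hcard, Finset.card_pos.1 (hcard ▸ hpos b hb), ?_⟩
  rw [← sum_shortSolutions hb]
  have := congrArg (fun m => (Multiset.map (fun k : ℕ => cosRat (k / 60)) m).sum) hE
  simp only [map_sum_singleton, sum_sum_singleton] at this
  simpa [hk] using this

theorem cosMultiset_eq_of_isPerm {n : ℕ} {φ ψ : Fin n → ℚ} {k : Fin n → ℕ}
    (hk : ∀ j, cosRat (φ j) = cosRat (k j / 60)) {l a : List ℕ}
    (hl : (l : Multiset ℕ) = ∑ j, {k j}) (h : l.isPerm a = true)
    (ha : (a.map fun k : ℕ => cosRat (k / 60)) = List.ofFn fun j => cosRat (ψ j)) :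
    cosMultiset φ = cosMultiset ψ := by
  have h1 : cosMultiset φ = ((l : Multiset ℕ)).map fun k : ℕ => cosRat (k / 60) := by
    rw [hl, map_sum_singleton]; simp only [cosMultiset, hk]
  rw [h1, Multiset.coe_eq_coe.2 (List.isPerm_iff.1 h), Multiset.map_coe, ha, cosMultiset,
    sum_singleton_eq_map, Fin.univ_val_map]

theorem isListedCos_of_sporadicSixty {n : ℕ} {φ : Fin n → ℚ} {k : Fin n → ℕ}
    (hk : ∀ j, cosRat (φ j) = cosRat (k j / 60)) {l a : List ℕ}
    (hl : (l : Multiset ℕ) = ∑ j, {k j}) (ha : a ∈ sporadicSixty)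
    (h : (l.isPerm a || l.isPerm (a.map fun x => 30 - x)) = true) : IsListedCos φ := by
  have hn : a.length = n := by
    have h1 : l.length = n := by
      have := congrArg Multiset.card hl
      simpa using this
    rw [Bool.or_eq_true] at h
    rw [← h1]
    rcases h with h | h
    · exact (List.isPerm_iff.1 h).length_eq.symm
    · simpa using (List.isPerm_iff.1 h).length_eq.symm
  suffices H : ∃ ψ ∈ cosSporadic n,
      (a.map fun k : ℕ => cosRat (k / 60)) = (List.ofFn fun j => cosRat (ψ j)) ∧
      ((a.map fun x => 30 - x).map fun k : ℕ => cosRat (k / 60)) =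
        List.ofFn fun j => cosRat (1 / 2 - ψ j) by
    obtain ⟨ψ, hψ, h1, h2⟩ := H
    refine ⟨ψ, Or.inl hψ, cosEquiv_iff.2 ?_⟩
    rw [Bool.or_eq_true] at h
    rcases h with h | h
    · exact Or.inl (cosMultiset_eq_of_isPerm hk hl h h1)
    · right
      rw [← cosMultiset_neg]
      exact cosMultiset_eq_of_isPerm hk hl h h2
  subst hn
  simp only [sporadicSixty, List.mem_cons, List.not_mem_nil, or_false] at ha
  rcases ha with rfl | rfl | rfl | rfl | rfl | rfl
  · exact ⟨![1 / 10, 3 / 10, 1 / 3], by simp [cosSporadic], by norm_num [List.ofFn_succ],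
      by norm_num [List.ofFn_succ]⟩
  · exact ⟨![0, 1 / 5, 1 / 3, 2 / 5], by simp [cosSporadic], by norm_num [List.ofFn_succ],
      by norm_num [List.ofFn_succ]⟩
  · exact ⟨![1 / 30, 1 / 6, 11 / 30, 2 / 5], by simp [cosSporadic], by norm_num [List.ofFn_succ],
      by norm_num [List.ofFn_succ]⟩
  · exact ⟨![1 / 15, 4 / 15, 3 / 10, 1 / 3], by simp [cosSporadic], by norm_num [List.ofFn_succ],
      by norm_num [List.ofFn_succ]⟩
  · exact ⟨![0, 1 / 30, 1 / 3, 11 / 30, 2 / 5], by simp [cosSporadic],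
      by norm_num [List.ofFn_succ], by norm_num [List.ofFn_succ]⟩
  · exact ⟨![0, 1 / 5, 7 / 30, 1 / 3, 13 / 30], by simp [cosSporadic],
      by norm_num [List.ofFn_succ], by norm_num [List.ofFn_succ]⟩

theorem isListedCos_of_familyShifts {n : ℕ} {φ : Fin n → ℚ} {k : Fin n → ℕ}
    (hk : ∀ j, cosRat (φ j) = cosRat (k j / 60)) {l s : List ℕ}
    (hl : (l : Multiset ℕ) = ∑ j, {k j}) (hs : s ∈ familyShifts) {t : ℕ}
    (h : l.isPerm (s.map fun x => foldSixty (t + x)) = true) : IsListedCos φ := by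
  have hn : s.length = n := by
    have h1 : l.length = n := by
      have := congrArg Multiset.card hl
      simpa using this
    rw [← h1]
    simpa using (List.isPerm_iff.1 h).length_eq.symm
  suffices H : ∃ F ∈ cosFamilies n,
      (s.map fun x : ℕ => cosRat (t / 60 + x / 60)) = List.ofFn fun j => cosRat (F (t / 60) j) by
    obtain ⟨F, hF, h1⟩ := H
    refine ⟨_, Or.inr ⟨F, hF, t / 60, rfl⟩, cosEquiv_iff.2 (Or.inl ?_)⟩
    refine cosMultiset_eq_of_isPerm hk hl h ?_
    rw [← h1, List.map_map]
    refine List.map_congr_left fun x _ => ?_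
    rw [Function.comp, cosRat_foldSixty]
    congr 1; push_cast; ring
  subst hn
  simp only [familyShifts, List.mem_cons, List.not_mem_nil, or_false] at hs
  rcases hs with rfl | rfl | rfl | rfl
  · refine ⟨_, List.mem_singleton_self _, ?_⟩
    have := cosRat_add_half (t / 60)
    rw [← cosRat_half_sub] at this
    norm_num [List.ofFn_succ] at this ⊢
    exact this
  · refine ⟨_, List.mem_singleton_self _, ?_⟩
    have := cosRat_add_int (t / 60 - 1 / 3) 1
    rw [show (t / 60 - 1 / 3 + (1 : ℤ) : ℚ) = t / 60 + 2 / 3 by push_cast; ring] at this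
    norm_num [List.ofFn_succ] at this ⊢
    exact this
  · exact ⟨_, List.mem_singleton_self _, by norm_num [List.ofFn_succ]⟩
  · refine ⟨_, List.mem_singleton_self _, ?_⟩
    have := cosRat_add_int (t / 60 - 1 / 6) 1
    rw [show (t / 60 - 1 / 6 + (1 : ℤ) : ℚ) = t / 60 + 5 / 6 by push_cast; ring] at this
    norm_num [List.ofFn_succ] at this ⊢
    exact this

theorem IrreducibleCos.isListedCos_of_isReducibleOrListed {n : ℕ} {φ : Fin n → ℚ}
    (hφ : IrreducibleCos φ) {k : Fin n → ℕ} (hk : ∀ j, cosRat (φ j) = cosRat (k j / 60))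
    {l : List ℕ} (hl : (l : Multiset ℕ) = ∑ j, {k j}) (h : isReducibleOrListed l = true) :
    IsListedCos φ := by
  have hn : l.length = n := by
    have := congrArg Multiset.card hl
    simpa using this
  simp only [isReducibleOrListed, Bool.or_eq_true, List.any_eq_true, Bool.and_eq_true] at h
  rcases h with (⟨b, hb, hlt, h⟩ | ⟨a, ha, h⟩) | ⟨s, hs, t, -, h⟩
  · obtain ⟨E, hE, hne, h0⟩ := exists_sum_eq_zero_of_shortSolution hk hl hb h
    have hlt : b.length < l.length := by simpa [Nat.blt_eq] using hlt
    rw [hφ.eq_univ hne h0, Finset.card_univ, Fintype.card_fin] at hE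
    omega
  · exact isListedCos_of_sporadicSixty hk hl ha (by simpa using h)
  · exact isListedCos_of_familyShifts hk hl hs h

/-- The factor 77 = 4620/60 rewrites numerators over 60 as numerators over 4620. -/
theorem sum_cosResidue_of_sum_cosRat {ι : Type*} (s : Finset ι) (k : ι → ℕ)
    (h : ∑ i ∈ s, cosRat (k i / 60) = 0) : (∑ i ∈ s, cosResidue (77 * k i)) % 9241 = 0 := by
  have := sum_cosResidue_mod s (fun i => 77 * (k i : ℤ)) (by
    rw [← h]
    refine Finset.sum_congr rfl fun i _ => ?_
    congr 1; push_cast; ring)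
  simpa using this

/-- An irreducible solution with denominator `60`, with all numerators even or all odd,
is listed. -/
theorem IrreducibleCos.isListedCos_of_denominator_sixty {n : ℕ} (h2 : 2 ≤ n) (h6 : n ≤ 6)
    {φ : Fin n → ℚ} (hφ : IrreducibleCos φ) (K : Fin n → ℤ) (hK : ∀ j, φ j * 60 = K j)
    (hpar : (∀ j, (2 : ℤ) ∣ K j) ∨ ∀ j, ¬ (2 : ℤ) ∣ K j) : IsListedCos φ := by
  set k : Fin n → ℕ := fun j => foldSixty (K j % 60).toNat with hkdef
  have hk : ∀ j, cosRat (φ j) = cosRat (k j / 60) := fun j => by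
    rw [hkdef, exists_foldSixty, ← hK j]; congr 1; ring
  have hr : (0 + ((∑ j, ({k j} : Multiset ℕ)).map fun x : ℕ => cosResidue (77 * x)).sum) % 9241
      = 0 := by
    rw [zero_add, map_sum_singleton, sum_singleton_eq_map]
    refine sum_cosResidue_of_sum_cosRat Finset.univ k ?_
    simp only [← hk]
    exact hφ.sum_eq_zero
  have hcheck : ∃ vs : List (ℕ × ℕ), (∀ v ∈ vs, v.2 = cosResidue (77 * v.1)) ∧
      (∀ j, k j ∈ vs.map Prod.fst) ∧
      checkSums 9241 isReducibleOrListed n vs 0 [] = true := by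
    rcases hpar with hpar | hpar
    · refine ⟨evenResidues, by decide +kernel, fun j => ?_, ?_⟩
      · have h1 : k j % 2 = 0 := by
          have := hpar j
          simp only [hkdef, foldSixty]; omega
        have h3 : k j ≤ 30 := foldSixty_le _
        generalize k j = x at h1 h3
        have : ∀ x ≤ 30, x % 2 = 0 → x ∈ evenResidues.map Prod.fst := by decide
        exact this x h3 h1
      · have := checkSums_evenResidues
        rw [List.all_eq_true] at this
        have := this (n - 2) (List.mem_range.2 (by omega))
        rwa [Nat.sub_add_cancel h2] at this
    · refine ⟨oddResidues, by decide +kernel, fun j => ?_, ?_⟩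
      · have h1 : k j % 2 = 1 := by
          have := hpar j
          simp only [hkdef, foldSixty]; omega
        have h3 : k j ≤ 30 := foldSixty_le _
        generalize k j = x at h1 h3
        have : ∀ x ≤ 30, x % 2 = 1 → x ∈ oddResidues.map Prod.fst := by decide
        exact this x h3 h1
      · have := checkSums_oddResidues
        rw [List.all_eq_true] at this
        have := this (n - 2) (List.mem_range.2 (by omega))
        rwa [Nat.sub_add_cancel h2] at this
  obtain ⟨vs, hvs, hmem, hc⟩ := hcheck
  obtain ⟨l, hl, hg⟩ := exists_good_of_checkSums (fun x : ℕ => cosResidue (77 * x)) n vs 0 [] hvs hc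
    (∑ j, {k j}) (by simp) (fun x hx => by
      rw [sum_singleton_eq_map, Multiset.mem_map] at hx
      obtain ⟨j, -, rfl⟩ := hx
      exact hmem j) hr
  exact hφ.isListedCos_of_isReducibleOrListed hk (by simpa using hl) hg

/-! ### The exponential equation. -/

theorem expRat_sixth_pair : expRat (1 / 6) + expRat (-(1 / 6)) = 1 := by
  rw [expRat_add_expRat_neg, cosRat_sixth]; norm_num

/-- Conjugating u + v = 1 on the unit circle gives 1/u + 1/v = 1, hence uv = 1, so u and v are the
two roots of X² - X + 1. -/
theorem expRat_add_eq_one {u v : ℚ} (h : expRat u + expRat v = 1) :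
    (expRat u = expRat (1 / 6) ∧ expRat v = expRat (-(1 / 6))) ∨
      (expRat u = expRat (-(1 / 6)) ∧ expRat v = expRat (1 / 6)) := by
  have h1 : expRat (-u) + expRat (-v) = 1 := by
    rw [← conj_expRat, ← conj_expRat, ← map_add, h, map_one]
  have hu := expRat_mul_neg u
  have hv := expRat_mul_neg v
  have hz := expRat_mul_neg (1 / 6)
  have hz' := expRat_sixth_pair
  have huv : expRat u * expRat v = 1 := by
    linear_combination expRat v * hu + expRat u * hv - expRat u * expRat v * h1 + h
  have h3 : (expRat u - expRat (1 / 6)) * (expRat u - expRat (-(1 / 6))) = 0 := by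
    linear_combination expRat u * h - huv + hz - expRat u * hz'
  rcases mul_eq_zero.1 h3 with h3 | h3
  · exact Or.inl ⟨sub_eq_zero.1 h3, by linear_combination h - h3 - hz'⟩
  · exact Or.inr ⟨sub_eq_zero.1 h3, by linear_combination h - h3 - hz'⟩

/-- Conjugation gives e₂ = e₃ for the elementary symmetric functions. With e₁ = 1 this makes
(1-u)(1-v)(1-w) vanish, so one of the numbers is 1 and the other two cancel. -/
theorem expRat_add_add_eq_one {u v w : ℚ} (h : expRat u + expRat v + expRat w = 1) :
    expRat v + expRat w = 0 ∨ expRat u + expRat w = 0 ∨ expRat u + expRat v = 0 := by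
  have h1 : expRat (-u) + expRat (-v) + expRat (-w) = 1 := by
    rw [← conj_expRat, ← conj_expRat, ← conj_expRat, ← map_add, ← map_add, h, map_one]
  have hu := expRat_mul_neg u
  have hv := expRat_mul_neg v
  have hw := expRat_mul_neg w
  have h2 : expRat v * expRat w + expRat u * expRat w + expRat u * expRat v =
      expRat u * expRat v * expRat w := by
    linear_combination expRat u * expRat v * expRat w * h1 - expRat v * expRat w * hu
      - expRat u * expRat w * hv - expRat u * expRat v * hw
  have h3 : (1 - expRat u) * ((1 - expRat v) * (1 - expRat w)) = 0 := by
    linear_combination h2 - h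
  rcases mul_eq_zero.1 h3 with h3 | h3
  · left; linear_combination h + h3
  · rcases mul_eq_zero.1 h3 with h3 | h3
    · right; left; linear_combination h + h3
    · right; right; linear_combination h + h3

/-- Numerators over `6` of the minimal vanishing sums of sixth roots of unity. -/
def sixthRootRelations : List (List ℕ) := [[0, 3], [1, 4], [2, 5], [0, 2, 4], [1, 3, 5]]

/-- For one to six terms, every vanishing sum of sixth roots of unity contains an antipodal pair or
a coset of the cube roots. The factor 770 is 4620/6. -/
theorem checkSums_sixth :
    ((List.range 6).all fun n => checkSums 9241
      (fun l => sixthRootRelations.any fun b => isSubmultiset b l) (n + 1)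
      ((List.range 6).map fun k => (k, expResidue (770 * k))) 0 []) = true := by
  decide +kernel

theorem exists_expFamily_of_mem_sixthRootRelations {b : List ℕ} (hb : b ∈ sixthRootRelations) :
    ∃ F ∈ expFamilies b.length, ∃ θ : ℚ,
      (b.map fun k : ℕ => expRat (k / 6)) = List.ofFn fun j => expRat (F θ j) := by
  simp only [sixthRootRelations, List.mem_cons, List.not_mem_nil, or_false] at hb
  rcases hb with rfl | rfl | rfl | rfl | rfl
  · exact ⟨_, List.mem_singleton_self _, 0, by norm_num [List.ofFn_succ]⟩
  · exact ⟨_, List.mem_singleton_self _, 1 / 6, by norm_num [List.ofFn_succ]⟩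
  · exact ⟨_, List.mem_singleton_self _, 2 / 6, by norm_num [List.ofFn_succ]⟩
  · exact ⟨_, List.mem_singleton_self _, 0, by norm_num [List.ofFn_succ]⟩
  · exact ⟨_, List.mem_singleton_self _, 1 / 6, by norm_num [List.ofFn_succ]⟩

theorem sum_expFamily {n : ℕ} (hn : n ≤ 6) {F : ℚ → Fin n → ℚ} (hF : F ∈ expFamilies n) (θ : ℚ) :
    ∑ j, expRat (F θ j) = 0 := by
  interval_cases n <;> simp only [expFamilies, List.mem_singleton, List.not_mem_nil] at hF
  · subst hF
    have := sum_range_expRat_add_div (p := 2) (by norm_num) θ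
    simpa [Finset.sum_range_succ, Fin.sum_univ_succ] using this
  · subst hF
    have := sum_range_expRat_add_div (p := 3) (by norm_num) θ
    simpa [Finset.sum_range_succ, Fin.sum_univ_succ, add_assoc] using this
  · subst hF
    have := sum_range_expRat_add_div (p := 5) (by norm_num) θ
    simpa [Finset.sum_range_succ, Fin.sum_univ_succ, add_assoc] using this
  · subst hF
    have h5 := sum_range_expRat_add_div (p := 5) (by norm_num) θ
    have h6 : expRat (θ - 1 / 6) + expRat (θ + 1 / 6) = expRat θ := by
      rw [sub_eq_add_neg, expRat_add, expRat_add, ← mul_add, add_comm (expRat (-(1 / 6))),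
        expRat_sixth_pair, mul_one]
    simp only [Finset.sum_range_succ, Finset.sum_range_zero, Nat.cast_zero, zero_div, add_zero,
      zero_add, Nat.cast_ofNat, Nat.cast_one] at h5
    simp only [Fin.sum_univ_six, Matrix.cons_val]
    rw [h6]; exact h5

theorem expFamilies_add {n : ℕ} (hn : n ≤ 6) {F : ℚ → Fin n → ℚ} (hF : F ∈ expFamilies n)
    (θ c : ℚ) (j : Fin n) : F (θ + c) j = F θ j + c := by
  interval_cases n <;> simp only [expFamilies, List.mem_singleton, List.not_mem_nil] at hF <;>
    subst hF <;> fin_cases j <;> simp <;> ring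

theorem IsListedExp.add {n : ℕ} (hn : n ≤ 6) {φ φ' : Fin n → ℚ} (h : IsListedExp φ') (c : ℚ)
    (hφ : ∀ j, φ j = φ' j + c) : IsListedExp φ := by
  obtain ⟨F, hF, θ, σ, h⟩ := h
  refine ⟨F, hF, θ + c, σ, fun j => ?_⟩
  obtain ⟨m, hm⟩ := h j
  exact ⟨m, by rw [hφ, hm, expFamilies_add hn hF]; ring⟩

/-- An irreducible vanishing sum of at most six sixth roots of unity is listed. -/
theorem IrreducibleExp.isListedExp_of_denominator_six {n : ℕ} (h1 : 1 ≤ n) (h6 : n ≤ 6)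
    {φ : Fin n → ℚ} (hφ : IrreducibleExp φ) (K : Fin n → ℤ) (hK : ∀ j, φ j * 6 = K j) :
    IsListedExp φ := by
  set k : Fin n → ℕ := fun j => (K j % 6).toNat with hkdef
  have hk : ∀ j, expRat (φ j) = expRat (k j / 6) := fun j => by
    rw [expRat_eq_iff]
    refine ⟨K j / 6, ?_⟩
    have h1 : (K j : ℚ) = 6 * (K j / 6 : ℤ) + (K j % 6 : ℤ) := by
      exact_mod_cast (Int.mul_ediv_add_emod (K j) 6).symm
    have h2 : (((K j % 6).toNat : ℤ) : ℚ) = (K j % 6 : ℤ) := by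
      rw [Int.toNat_of_nonneg (Int.emod_nonneg _ (by norm_num))]
    have h3 : ((k j : ℤ) : ℚ) = (K j % 6 : ℤ) := h2
    rw [← hK j, ← h3, Int.cast_natCast] at h1
    linarith
  have hr : (0 + ((∑ j, ({k j} : Multiset ℕ)).map fun x : ℕ => expResidue (770 * x)).sum) % 9241
      = 0 := by
    rw [zero_add, map_sum_singleton, sum_singleton_eq_map]
    have := sum_expResidue_mod Finset.univ (fun j => 770 * (k j : ℤ)) (by
      rw [← hφ.sum_eq_zero]
      refine Finset.sum_congr rfl fun j _ => ?_
      rw [hk j]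
      congr 1; push_cast; ring)
    exact this
  have hc := checkSums_sixth
  rw [List.all_eq_true] at hc
  have hc := hc (n - 1) (List.mem_range.2 (by omega))
  rw [Nat.sub_add_cancel h1] at hc
  obtain ⟨l, hl, hg⟩ := exists_good_of_checkSums (fun x : ℕ => expResidue (770 * x)) n _ 0 []
    (by simp) hc (∑ j, {k j}) (by simp) (fun x hx => by
      rw [sum_singleton_eq_map, Multiset.mem_map] at hx
      obtain ⟨j, -, rfl⟩ := hx
      have h3 : k j < 6 := by simp only [hkdef]; omega
      simpa using h3) hr
  rw [Multiset.coe_nil, add_zero] at hl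
  rw [List.any_eq_true] at hg
  obtain ⟨b, hb, hg⟩ := hg
  obtain ⟨F, hF, θ, hFθ⟩ := exists_expFamily_of_mem_sixthRootRelations hb
  have hle := coe_le_of_isSubmultiset hg
  -- The relation found occupies a set E of indices with vanishing sum; irreducibility forces E to
  -- be everything, so the tuple is that relation.
  obtain ⟨E, hE⟩ := exists_finset_of_le_sum_singleton k (hl ▸ hle)
  have hcard : E.card = b.length := by
    have := congrArg Multiset.card hE
    simpa using this
  have hlen : ∀ b ∈ sixthRootRelations, 0 < b.length ∧ b.length ≤ 6 := by decide
  have hEm : ∑ j ∈ E, {expRat (φ j)} = (List.ofFn fun j => expRat (F θ j) : Multiset ℂ) := by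
    rw [← hFθ, ← Multiset.map_coe, ← hE, map_sum_singleton]
    simp only [hk]
  have hsum : ∑ j ∈ E, expRat (φ j) = 0 := by
    have := congrArg Multiset.sum hEm
    rw [sum_singleton_eq_map, Multiset.sum_coe, List.sum_ofFn] at this
    rw [← sum_expFamily (hlen b hb).2 hF θ, ← this]; rfl
  have huniv := hφ.eq_univ (Finset.card_pos.1 (hcard ▸ (hlen b hb).1)) hsum
  have hn : b.length = n := by
    rw [← hcard, huniv, Finset.card_univ, Fintype.card_fin]
  subst hn
  refine ⟨F, hF, θ, expEquiv_iff.2 ?_⟩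
  rw [huniv] at hEm
  rw [expMultiset, hEm, expMultiset, sum_singleton_eq_map, Fin.univ_val_map]

/-- The class of `a` modulo `5` determines the root of unity `exp (2πia/5)`. -/
noncomputable def fifthRoot (c : ZMod 5) : ℂ := expRat (c.val / 5)

theorem fifthRoot_intCast (a : ℤ) : expRat (a / 5) = fifthRoot (a : ZMod 5) := by
  rw [fifthRoot, expRat_eq_iff]
  refine ⟨a / 5, ?_⟩
  have h1 : (a : ℚ) = 5 * (a / 5 : ℤ) + (a % 5 : ℤ) := by
    exact_mod_cast (Int.mul_ediv_add_emod a 5).symm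
  have h2 : (((a : ZMod 5).val : ℤ) : ℚ) = (a % 5 : ℤ) := by
    rw [ZMod.val_intCast]; rfl
  rw [Int.cast_natCast] at h2
  rw [h2]
  linarith

theorem fifthRoot_add (c d : ZMod 5) : fifthRoot (c + d) = fifthRoot c * fifthRoot d := by
  have hc : c = ((c.val : ℤ) : ZMod 5) := by simp
  have hd : d = ((d.val : ℤ) : ZMod 5) := by simp
  conv_lhs => rw [hc, hd, ← Int.cast_add, ← fifthRoot_intCast]
  rw [fifthRoot, fifthRoot, ← expRat_add]
  congr 1; push_cast; ring

/-- Five nonempty classes with five or six elements in all leave room for at most one class with two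
elements. When all are singletons, c₀ may be any class. -/
theorem exists_large_class {m : ZMod 5 → ℕ} {n : ℕ} (h5 : n = 5 ∨ n = 6) (hm : ∀ c, 1 ≤ m c)
    (hsum : ∑ c, m c = n) : ∃ c₀, m c₀ + 4 = n ∧ ∀ d : ZMod 5, d ≠ 0 → m (c₀ + d) = 1 := by
  have hs : m 0 + m 1 + m 2 + m 3 + m 4 = n := by rw [← hsum]; exact (Fin.sum_univ_five m).symm
  have h0 := hm 0
  have h1 := hm 1
  have h2 := hm 2
  have h3 := hm 3
  have h4 := hm 4
  have key : ∀ c₀ : ZMod 5, (m c₀ + 4 = n ∧ (m 0 = 1 ∨ c₀ = 0) ∧ (m 1 = 1 ∨ c₀ = 1) ∧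
      (m 2 = 1 ∨ c₀ = 2) ∧ (m 3 = 1 ∨ c₀ = 3) ∧ (m 4 = 1 ∨ c₀ = 4)) →
      ∃ c₀, m c₀ + 4 = n ∧ ∀ d : ZMod 5, d ≠ 0 → m (c₀ + d) = 1 := by
    rintro c₀ ⟨hc, g0, g1, g2, g3, g4⟩
    refine ⟨c₀, hc, fun d hd => ?_⟩
    have hne : c₀ + d ≠ c₀ := fun h => hd (by simpa using h)
    generalize c₀ + d = e at hne
    have : ∀ e : ZMod 5, e = 0 ∨ e = 1 ∨ e = 2 ∨ e = 3 ∨ e = 4 := by decide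
    rcases this e with rfl | rfl | rfl | rfl | rfl
    · exact g0.resolve_right hne.symm
    · exact g1.resolve_right hne.symm
    · exact g2.resolve_right hne.symm
    · exact g3.resolve_right hne.symm
    · exact g4.resolve_right hne.symm
  by_cases e1 : 2 ≤ m 1
  · exact key 1 ⟨by omega, Or.inl (by omega), Or.inr rfl, Or.inl (by omega),
      Or.inl (by omega), Or.inl (by omega)⟩
  by_cases e2 : 2 ≤ m 2
  · exact key 2 ⟨by omega, Or.inl (by omega), Or.inl (by omega), Or.inr rfl,
      Or.inl (by omega), Or.inl (by omega)⟩
  by_cases e3 : 2 ≤ m 3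
  · exact key 3 ⟨by omega, Or.inl (by omega), Or.inl (by omega), Or.inl (by omega),
      Or.inr rfl, Or.inl (by omega)⟩
  by_cases e4 : 2 ≤ m 4
  · exact key 4 ⟨by omega, Or.inl (by omega), Or.inl (by omega), Or.inl (by omega),
      Or.inl (by omega), Or.inr rfl⟩
  · exact key 0 ⟨by omega, Or.inr rfl, Or.inl (by omega), Or.inl (by omega),
      Or.inl (by omega), Or.inl (by omega)⟩

theorem expMultiset_five_shift (θ : ℚ) (f : Fin 5 → ℂ)
    (hf : ∀ d : ZMod 5, d ≠ 0 → f d = expRat θ * fifthRoot d) :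
    ∑ d : Fin 5, ({f d} : Multiset ℂ) = {f 0} + {expRat (θ + 1 / 5)} + {expRat (θ + 2 / 5)} +
      {expRat (θ + 3 / 5)} + {expRat (θ + 4 / 5)} := by
  have h : ∀ d : ZMod 5, d ≠ 0 → f d = expRat (θ + d.val / 5) := fun d hd => by
    rw [hf d hd, expRat_add]; rfl
  have h1 : f 1 = expRat (θ + 1 / 5) := by
    have := h 1 (by decide); rwa [show ((1 : ZMod 5).val : ℚ) = 1 by rfl] at this
  have h2 : f 2 = expRat (θ + 2 / 5) := by
    have := h 2 (by decide); rwa [show ((2 : ZMod 5).val : ℚ) = 2 by rfl] at this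
  have h3 : f 3 = expRat (θ + 3 / 5) := by
    have := h 3 (by decide); rwa [show ((3 : ZMod 5).val : ℚ) = 3 by rfl] at this
  have h4 : f 4 = expRat (θ + 4 / 5) := by
    have := h 4 (by decide); rwa [show ((4 : ZMod 5).val : ℚ) = 4 by rfl] at this
  rw [Fin.sum_univ_five, h1, h2, h3, h4]

/-- A sum of five or six roots of unity whose components along the fifth roots of unity are all
equal and nonempty is listed. -/
theorem isListedExp_of_fifthRoot_components {n : ℕ} (h6 : n ≤ 6) {φ b : Fin n → ℚ} {a : Fin n → ℤ}
    (hφ : ∀ j, φ j = a j / 5 + b j) {α : ℂ}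
    (hα : ∀ c : ZMod 5, ∑ j with (a j : ZMod 5) = c, expRat (b j) = α)
    (hne : ∀ c : ZMod 5, ∃ j, (a j : ZMod 5) = c) : IsListedExp φ := by
  have hval : ∀ j, expRat (φ j) = fifthRoot (a j : ZMod 5) * expRat (b j) := fun j => by
    rw [hφ, expRat_add, fifthRoot_intCast]
  set S : ZMod 5 → Finset (Fin n) := fun c => Finset.univ.filter fun j => (a j : ZMod 5) = c with hS
  have hcard : ∑ c, (S c).card = n := by
    have := Finset.card_eq_sum_card_fiberwise (s := (Finset.univ : Finset (Fin n)))
      (t := (Finset.univ : Finset (ZMod 5))) (f := fun j => (a j : ZMod 5)) (by simp)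
    simpa using this.symm
  have hpos : ∀ c, 1 ≤ (S c).card := fun c => by
    obtain ⟨j, hj⟩ := hne c
    exact Finset.card_pos.2 ⟨j, by simp [hS, hj]⟩
  have hn5 : n = 5 ∨ n = 6 := by
    have : ∑ c : ZMod 5, 1 ≤ ∑ c, (S c).card := Finset.sum_le_sum fun c _ => hpos c
    rw [hcard] at this
    simp at this
    omega
  obtain ⟨c₀, hc₀, hc⟩ := exists_large_class hn5 hpos hcard
  have hmem : ∀ {c j}, j ∈ S c → (a j : ZMod 5) = c := fun h => (Finset.mem_filter.1 h).2
  have hsingle : ∀ d : ZMod 5, (S (c₀ + d)).card = 1 →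
      ∑ j ∈ S (c₀ + d), ({expRat (φ j)} : Multiset ℂ) = {fifthRoot c₀ * α * fifthRoot d} := by
    intro d hd
    obtain ⟨j, hj⟩ := Finset.card_eq_one.1 hd
    have h1 := hα (c₀ + d)
    change ∑ j ∈ S (c₀ + d), _ = α at h1
    rw [hj, Finset.sum_singleton] at h1
    rw [hj, Finset.sum_singleton, hval j, hmem (hj ▸ Finset.mem_singleton_self j), h1,
      fifthRoot_add]
    congr 1; ring
  -- Since other classes are singletons, α is itself a root of unity. The angle θ is normalised so
  -- that the singleton class c₀ + d contributes the angle θ + d/5.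
  obtain ⟨θ, hθ⟩ : ∃ θ, fifthRoot c₀ * α = expRat θ := by
    obtain ⟨j, hj⟩ := Finset.card_eq_one.1 (hc 1 (by decide))
    have h1 := hα (c₀ + 1)
    change ∑ j ∈ S (c₀ + 1), _ = α at h1
    rw [hj, Finset.sum_singleton] at h1
    exact ⟨c₀.val / 5 + b j, by rw [← h1, expRat_add]; rfl⟩
  have hdecomp : expMultiset φ = ∑ d : ZMod 5, ∑ j ∈ S (c₀ + d), {expRat (φ j)} := by
    refine Eq.trans ?_ (Equiv.sum_comp (Equiv.addLeft c₀)
      fun c => ∑ j ∈ S c, ({expRat (φ j)} : Multiset ℂ)).symm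
    exact (Finset.sum_fiberwise _ _ _).symm
  have hrest : expMultiset φ = ∑ j ∈ S c₀, {expRat (φ j)} + ({expRat (θ + 1 / 5)} +
      {expRat (θ + 2 / 5)} + {expRat (θ + 3 / 5)} + {expRat (θ + 4 / 5)}) := by
    have h1 := expMultiset_five_shift θ (fun d => expRat θ * fifthRoot d) fun _ _ => rfl
    change ∑ d : ZMod 5, ({expRat θ * fifthRoot d} : Multiset ℂ) = _ at h1
    rw [← Finset.add_sum_erase _ _ (Finset.mem_univ (0 : ZMod 5))] at h1
    rw [hdecomp, ← Finset.add_sum_erase _ _ (Finset.mem_univ (0 : ZMod 5)), add_zero]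
    congr 1
    rw [Finset.sum_congr rfl fun d hd => hsingle d (hc d (Finset.ne_of_mem_erase hd)), hθ]
    simp only [add_assoc] at h1 ⊢
    exact add_left_cancel h1
  rcases hn5 with rfl | rfl
  · refine ⟨_, List.mem_singleton_self _, θ, expEquiv_iff.2 ?_⟩
    have h0 := hsingle 0 (by rw [add_zero]; omega)
    have h1 : fifthRoot 0 = 1 := by simp [fifthRoot, expRat_zero]
    rw [add_zero, h1, mul_one, hθ] at h0
    rw [hrest, h0]
    simp only [expMultiset, Fin.sum_univ_five, Matrix.cons_val]
    abel
  · refine ⟨_, List.mem_singleton_self _, θ, expEquiv_iff.2 ?_⟩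
    obtain ⟨i, j, hij, h0⟩ := Finset.card_eq_two.1 (show (S c₀).card = 2 by omega)
    have h1 := hα c₀
    change ∑ j ∈ S c₀, _ = α at h1
    have hi : (a i : ZMod 5) = c₀ := hmem (by simp [h0])
    have hj : (a j : ZMod 5) = c₀ := hmem (by simp [h0])
    rw [h0, Finset.sum_pair hij] at h1
    -- The exceptional class has two terms with sum e(θ). After division by e(θ) they sum to 1, so
    -- the angles are θ ± 1/6.
    have h2 : expRat (φ i - θ) + expRat (φ j - θ) = 1 := by
      rw [sub_eq_add_neg, sub_eq_add_neg, expRat_add, expRat_add, hval, hval, hi, hj, ← add_mul,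
        ← mul_add, h1, hθ, expRat_mul_neg]
    have h3 : ∀ x y : ℚ, expRat (x - θ) = expRat y → expRat x = expRat (θ + y) := fun x y h => by
      rw [expRat_add, ← h, ← expRat_add]; congr 1; ring
    rw [hrest, h0, Finset.sum_pair hij]
    rcases expRat_add_eq_one h2 with ⟨g1, g2⟩ | ⟨g1, g2⟩
    · rw [h3 _ _ g1, h3 _ _ g2, ← sub_eq_add_neg]
      simp only [expMultiset, Fin.sum_univ_six, Matrix.cons_val]
      abel
    · rw [h3 _ _ g1, h3 _ _ g2, ← sub_eq_add_neg]
      simp only [expMultiset, Fin.sum_univ_six, Matrix.cons_val]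
      abel

/-- If the denominators of the angles are divisible by the prime `p` exactly once, then the
components along the `p`-th roots of unity are nonzero. -/
theorem IrreducibleExp.exists_class {n : ℕ} {φ b : Fin n → ℚ} (hφ : IrreducibleExp φ)
    {p M : ℕ} (hp : p.Prime) (hM : 0 < M) (hpM : ¬ p ∣ M) {a : Fin n → ℤ}
    (hab : ∀ j, φ j = a j / p + b j) (hb : ∀ j, ∃ k : ℤ, b j * M = k)
    {i : Fin n} (hi : (p : ℤ) ∣ a i) (hmin : ¬ ∀ j, ∃ k : ℤ, φ j * M = k) (c : ℤ) :
    ∃ j, (p : ℤ) ∣ a j - c := by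
  have hp0 : (p : ℂ) ≠ 0 := by exact_mod_cast hp.ne_zero
  -- An empty class would make the common component zero. The class of 0, which contains i, would
  -- then be a vanishing subsum, hence everything, and M would be a smaller common denominator.
  by_contra hc
  push Not at hc
  have hsum : ∑ j, expRat (a j / p + b j) = 0 := by
    simp only [← hab]; exact hφ.sum_eq_zero
  have h1 := sum_expRat_filter_eq Finset.univ hp hM hpM a b hb hsum
  have h2 : ∑ j, expRat (b j) = 0 := by
    rw [← h1 c, Finset.filter_false_of_mem (fun j _ => hc j)]; simp
  have h3 := h1 0
  rw [h2, mul_eq_zero] at h3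
  have h3 := h3.resolve_left hp0
  have hper : ∀ j, (p : ℤ) ∣ a j → ∃ m : ℤ, φ j = b j + m := fun j hj => by
    obtain ⟨m, hm⟩ := hj
    refine ⟨m, ?_⟩
    have : (p : ℚ) ≠ 0 := by exact_mod_cast hp.ne_zero
    rw [hab, hm]; push_cast; field_simp; ring
  have h4 : ∑ j with (p : ℤ) ∣ a j - 0, expRat (φ j) = 0 := by
    rw [← h3]
    refine Finset.sum_congr rfl fun j hj => ?_
    exact expRat_eq_iff.2 (hper j (by simpa using hj))
  have h5 := hφ.eq_univ ⟨i, by simpa using hi⟩ h4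
  refine hmin fun j => ?_
  have hj : j ∈ (Finset.univ : Finset (Fin n)) := Finset.mem_univ j
  rw [← h5] at hj
  obtain ⟨m, hm⟩ := hper j (by simpa using hj)
  obtain ⟨k, hk⟩ := hb j
  exact ⟨k + m * M, by rw [hm, add_mul, hk]; push_cast; ring⟩

/-- The irreducible vanishing sums of at most six roots of unity are listed. -/
theorem IrreducibleExp.isListedExp {n : ℕ} (h1 : 1 ≤ n) (h6 : n ≤ 6) {φ₀ : Fin n → ℚ}
    (hφ₀ : IrreducibleExp φ₀) : IsListedExp φ₀ := by
  set z : Fin n := ⟨0, h1⟩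
  -- Rotating one angle to 0 guarantees that the zero class modulo every prime is nonempty.
  set φ : Fin n → ℚ := fun j => φ₀ j - φ₀ z with hφdef
  have hφ : IrreducibleExp φ := hφ₀.of_mul (expRat_ne_zero (-φ₀ z)) fun j => by
    rw [← expRat_add]; congr 1; simp only [hφdef]; ring
  suffices H : IsListedExp φ from H.add h6 (φ₀ z) fun j => by simp [hφdef]
  have hz : φ z = 0 := by simp [hφdef]
  obtain ⟨N, hN, hNφ, hmin⟩ := exists_minimal_denominator φ
  -- If p² divided N, the numerators divisible by p would form a nonempty vanishing subsum, hence
  -- all of them, and N/p would already be a common denominator.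
  have hsq : ∀ p : ℕ, p.Prime → ¬ p * p ∣ N := fun p hp hd => by
    obtain ⟨M', rfl⟩ := hd
    have hM' : 0 < M' := Nat.pos_of_mul_pos_left hN
    have hM : 0 < p * M' := Nat.mul_pos hp.pos hM'
    have hp0 : (p : ℚ) ≠ 0 := by exact_mod_cast hp.ne_zero
    choose k hk using hNφ
    have hk' : ∀ j, φ j * (p * (p * M') : ℕ) = k j := fun j => by rw [← hk j, mul_assoc]
    have h0 := sum_expRat_filter_eq_zero Finset.univ hp hM (Dvd.intro _ rfl) φ k hk'
      hφ.sum_eq_zero 0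
    have hkz : k z = 0 := by
      have := hk z
      rw [hz, zero_mul] at this
      exact_mod_cast this.symm
    have h5 := hφ.eq_univ ⟨z, by simp [hkz]⟩ h0
    refine hmin (p * M') hM ?_ fun j => ?_
    · rw [mul_assoc]
      exact lt_mul_of_one_lt_left hM hp.one_lt
    · have hj : j ∈ (Finset.univ : Finset (Fin n)) := Finset.mem_univ j
      rw [← h5] at hj
      obtain ⟨m, hm⟩ : (p : ℤ) ∣ k j := by simpa using hj
      refine ⟨m, mul_left_cancel₀ hp0 ?_⟩
      have := hk' j
      rw [hm] at this
      push_cast at this ⊢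
      rw [← this]; ring
  have hclass : ∀ p M : ℕ, p.Prime → N = p * M → ∃ (a : Fin n → ℤ) (b : Fin n → ℚ),
      (∀ j, φ j = a j / p + b j) ∧ (∀ j, ∃ k : ℤ, b j * M = k) ∧
      ∀ c : ℤ, ∃ j, (p : ℤ) ∣ a j - c := fun p M hp hpM => by
    have hM : 0 < M := Nat.pos_of_mul_pos_left (hpM ▸ hN)
    have hnd : ¬ p ∣ M := fun hd => hsq p hp (hpM ▸ Nat.mul_dvd_mul_left p hd)
    have hcop : p.Coprime M := (Nat.Prime.coprime_iff_not_dvd hp).2 hnd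
    have hp0 : (p : ℚ) ≠ 0 := by exact_mod_cast hp.ne_zero
    choose a b hab hb using fun j => exists_eq_div_add hp.pos hM hcop (hpM ▸ hNφ j)
    refine ⟨a, b, hab, hb, hφ.exists_class hp hM hnd hab hb (i := z) ?_
      (hmin M hM (by rw [hpM]; exact lt_mul_of_one_lt_left hM hp.one_lt))⟩
    obtain ⟨k, hk⟩ := hb z
    have h2 := hab z
    rw [hz] at h2
    have h3 : (a z : ℚ) * M = p * (-k : ℤ) := by
      push_cast
      rw [← hk]
      field_simp at h2
      linear_combination -M * h2
    have h4 : a z * M = p * (-k) := by exact_mod_cast h3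
    exact (Nat.isCoprime_iff_coprime.2 hcop).dvd_of_dvd_mul_right ⟨_, h4⟩
  -- All p classes are occupied by n ≤ 6 terms.
  have hle : ∀ p : ℕ, p.Prime → p ∣ N → p ≤ 6 := fun p hp hd => by
    obtain ⟨M, hM⟩ := hd
    obtain ⟨a, b, -, -, hc⟩ := hclass p M hp hM
    have : NeZero p := ⟨hp.ne_zero⟩
    have hsurj : Function.Surjective fun j : Fin n => (a j : ZMod p) := fun c => by
      obtain ⟨j, hj⟩ := hc c.val
      refine ⟨j, ?_⟩
      rw [← ZMod.intCast_zmod_eq_zero_iff_dvd] at hj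
      simpa [sub_eq_zero] using hj
    have := Fintype.card_le_of_surjective _ hsurj
    rw [ZMod.card, Fintype.card_fin] at this
    omega
  by_cases h5 : 5 ∣ N
  · obtain ⟨M, hM⟩ := h5
    obtain ⟨a, b, hab, hb, hc⟩ := hclass 5 M (by norm_num) hM
    have hMpos : 0 < M := Nat.pos_of_mul_pos_left (hM ▸ hN)
    have hnd : ¬ 5 ∣ M := fun hd => hsq 5 (by norm_num) (hM ▸ Nat.mul_dvd_mul_left 5 hd)
    have hdvd : ∀ (x : ℤ) (c : ZMod 5), (x : ZMod 5) = c ↔ ((5 : ℕ) : ℤ) ∣ x - (c.val : ℤ) :=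
      fun x c => by
        rw [← ZMod.intCast_zmod_eq_zero_iff_dvd]
        simp [sub_eq_zero]
    refine isListedExp_of_fifthRoot_components h6 (α := (5 : ℂ)⁻¹ * ∑ j, expRat (b j))
      (by exact_mod_cast hab) (fun c => ?_) fun c => ?_
    · have := sum_expRat_filter_eq Finset.univ (by norm_num : Nat.Prime 5) hMpos hnd a b hb (by
        simp only [← hab]; exact hφ.sum_eq_zero) (c.val)
      rw [← this]
      simp only [hdvd]
      push_cast
      ring
    · obtain ⟨j, hj⟩ := hc c.val
      exact ⟨j, (hdvd _ _).2 hj⟩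
  · have hN6 : N ∣ 6 := by
      rw [Nat.dvd_iff_prime_pow_dvd_dvd]
      intro p k hp hd
      rcases k with _ | _ | k
      · simp
      · rw [zero_add, pow_one] at hd ⊢
        have := hle p hp hd
        have h2 := hp.two_le
        interval_cases p
        · norm_num
        · norm_num
        · exact absurd hp (by norm_num)
        · exact absurd hd h5
        · norm_num
      · exact absurd ((by rw [pow_add, pow_two]; exact Dvd.intro_left _ rfl :
          p * p ∣ p ^ (k + 2)).trans hd) (hsq p hp)
    obtain ⟨m, hm⟩ := hN6
    choose k hk using hNφ
    refine hφ.isListedExp_of_denominator_six h1 h6 (fun j => k j * m) fun j => ?_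
    push_cast
    rw [← hk j, mul_assoc]
    congr 1
    exact_mod_cast hm

/-! ### The cosine equation: reduction to the exponential equation. -/

/-- If a choice of signs turns an irreducible solution of the cosine equation into a solution of
the exponential equation, then it is listed. -/
theorem IrreducibleCos.isListedCos_of_sum_expRat {n : ℕ} (h1 : 1 ≤ n) (h6 : n ≤ 6)
    {φ ψ : Fin n → ℚ} (hφ : IrreducibleCos φ) (hψ : ∀ j, cosRat (ψ j) = cosRat (φ j))
    (h : ∑ j, expRat (ψ j) = 0) : IsListedCos φ := by
  have hirr : IrreducibleExp ψ := by
    -- A vanishing proper subsum of the exponentials would have a vanishing real part, against the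
    -- irreducibility of the cosine sum.
    refine ⟨h, fun E hE hne h0 => hφ.2 E hE hne ?_⟩
    have h0 : ∑ j ∈ E, expRat (ψ j) = 0 := h0
    have := congrArg Complex.re h0
    simp only [Complex.re_sum, expRat_re, Complex.zero_re, hψ] at this
    exact this
  exact ((hirr.isListedExp h1 h6).isListedCos h6).congr hψ

/-- A cosine sum is treated as a sum of exponentials indexed by two copies of the indices, one for φ
and one for -φ. -/
theorem sum_filter_sum_elim {ι : Type*} [Fintype ι] (q : ℤ → Prop) [DecidablePred q] (k : ι → ℤ)
    (f : ℚ → ℂ) (x : ι → ℚ) :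
    ∑ i with q (Sum.elim k (-k) i), f (Sum.elim x (-x) i) =
      ∑ j with q (k j), f (x j) + ∑ j with q (-k j), f (-x j) := by
  simp only [Finset.sum_filter, Fintype.sum_sum_type, Sum.elim_inl, Sum.elim_inr, Pi.neg_apply]
  rfl

theorem IrreducibleCos.sum_expRat {n : ℕ} {φ : Fin n → ℚ} (hφ : IrreducibleCos φ) :
    ∑ i, expRat (Sum.elim φ (-φ) i) = 0 := by
  rw [Fintype.sum_sum_type, ← Finset.sum_add_distrib]
  simp only [Sum.elim_inl, Sum.elim_inr, Pi.neg_apply, expRat_add_expRat_neg, ← Finset.mul_sum,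
    ← Complex.ofReal_sum, hφ.sum_eq_zero]
  simp

theorem sum_cosRat_of_sum_expRat {ι : Type*} {s t : Finset ι} {φ : ι → ℚ}
    (h : ∑ j ∈ s, expRat (φ j) + ∑ j ∈ t, expRat (-φ j) = 0) :
    ∑ j ∈ s, cosRat (φ j) + ∑ j ∈ t, cosRat (φ j) = 0 := by
  have := congrArg Complex.re h
  simpa only [Complex.add_re, Complex.re_sum, expRat_re, Complex.zero_re, cosRat_neg] using this

/-- If the exponents of an irreducible solution of the cosine equation split into vanishing sums
according to classes modulo an odd prime, then it is listed, unless all classes are zero. -/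
theorem IrreducibleCos.isListedCos_of_classes {n : ℕ} (h1 : 1 ≤ n) (h6 : n ≤ 6)
    {φ : Fin n → ℚ} (hφ : IrreducibleCos φ) {p : ℕ} (hp : p.Prime) (hp2 : p ≠ 2) {k : Fin n → ℤ}
    (h : ∀ c : ℤ, ∑ j with (p : ℤ) ∣ k j - c, expRat (φ j) +
      ∑ j with (p : ℤ) ∣ -k j - c, expRat (-φ j) = 0) :
    (∀ j, (p : ℤ) ∣ k j) ∨ IsListedCos φ := by
  classical
  by_contra! hcon
  obtain ⟨⟨i, hi⟩, hnot⟩ := hcon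
  refine hnot ?_
  -- For p odd and k i not divisible by p, the classes of k i and -k i differ. An index therefore
  -- enters the class of k i with at most one sign, and that sign defines ψ.
  have hdisj : Disjoint (Finset.univ.filter fun j => (p : ℤ) ∣ k j - k i)
      (Finset.univ.filter fun j => (p : ℤ) ∣ -k j - k i) := by
    rw [Finset.disjoint_filter]
    intro j _ hj1 hj2
    have h2 : (p : ℤ) ∣ 2 * k i := by
      have := dvd_add hj1 hj2
      rw [← dvd_neg]
      convert this using 1; ring
    rcases Int.Prime.dvd_mul' hp h2 with h2 | h2
    · have : p ∣ 2 := by exact_mod_cast h2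
      exact hp2 ((Nat.prime_dvd_prime_iff_eq hp Nat.prime_two).1 this)
    · exact hi h2
  have h0 := sum_cosRat_of_sum_expRat (h (k i))
  rw [← Finset.sum_union hdisj] at h0
  have huniv := hφ.eq_univ ⟨i, by simp⟩ h0
  refine hφ.isListedCos_of_sum_expRat h1 h6
    (ψ := fun j => if (p : ℤ) ∣ k j - k i then φ j else -φ j) (fun j => ?_) ?_
  · split_ifs
    · rfl
    · rw [cosRat_neg]
  · rw [← huniv, Finset.sum_union hdisj, ← h (k i)]
    congr 1
    · refine Finset.sum_congr rfl fun j hj => ?_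
      rw [if_pos (Finset.mem_filter.1 hj).2]
    · refine Finset.sum_congr rfl fun j hj => ?_
      rw [if_neg fun hj' => Finset.disjoint_left.1 hdisj
        (Finset.mem_filter.2 ⟨Finset.mem_univ _, hj'⟩) hj]

/-- If `p` divides `N / p`, then the vanishing sum splits according to the exponents modulo `p`. -/
theorem IrreducibleCos.sum_filter {n : ℕ} {φ : Fin n → ℚ} (hφ : IrreducibleCos φ) {p M : ℕ}
    (hp : p.Prime) (hM : 0 < M) (hpM : p ∣ M) {k : Fin n → ℤ}
    (hk : ∀ j, φ j * (p * M : ℕ) = k j) (c : ℤ) :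
    ∑ j with (p : ℤ) ∣ k j - c, expRat (φ j) +
      ∑ j with (p : ℤ) ∣ -k j - c, expRat (-φ j) = 0 := by
  rw [← sum_filter_sum_elim (fun x => (p : ℤ) ∣ x - c) k expRat φ]
  refine sum_expRat_filter_eq_zero Finset.univ hp hM hpM _ _ ?_ hφ.sum_expRat c
  rintro (j | j)
  · exact hk j
  · simp only [Sum.elim_inr, Pi.neg_apply, neg_mul, hk j, Int.cast_neg]

/-- The denominator `N` is the least one for the tuple `φ`. -/
structure IsMinimalDenominator {n : ℕ} (φ : Fin n → ℚ) (N : ℕ) : Prop where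
  pos : 0 < N
  exists_int : ∀ j, ∃ k : ℤ, φ j * N = k
  minimal : ∀ M : ℕ, 0 < M → M < N → ¬ ∀ j, ∃ k : ℤ, φ j * M = k

theorem IsMinimalDenominator.not_forall_dvd {n : ℕ} {φ : Fin n → ℚ} {p M : ℕ} (hp : p.Prime)
    (h : IsMinimalDenominator φ (p * M)) {k : Fin n → ℤ} (hk : ∀ j, φ j * (p * M : ℕ) = k j) :
    ¬ ∀ j, (p : ℤ) ∣ k j := by
  intro hd
  have hM : 0 < M := Nat.pos_of_mul_pos_left h.pos
  have hp0 : (p : ℚ) ≠ 0 := by exact_mod_cast hp.ne_zero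
  refine h.minimal M hM (lt_mul_of_one_lt_left hM hp.one_lt) fun j => ?_
  obtain ⟨m, hm⟩ := hd j
  refine ⟨m, mul_left_cancel₀ hp0 ?_⟩
  have := hk j
  rw [hm] at this
  push_cast at this ⊢
  rw [← this]; ring

theorem IrreducibleCos.isListedCos_of_odd_sq_dvd {n : ℕ} (h1 : 1 ≤ n) (h6 : n ≤ 6)
    {φ : Fin n → ℚ} (hφ : IrreducibleCos φ) {N : ℕ} (hN : IsMinimalDenominator φ N) {p : ℕ}
    (hp : p.Prime) (hp2 : p ≠ 2) (hd : p * p ∣ N) : IsListedCos φ := by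
  obtain ⟨M', rfl⟩ := hd
  rw [mul_assoc] at hN
  choose k hk using hN.exists_int
  exact (hφ.isListedCos_of_classes h1 h6 hp hp2
    (hφ.sum_filter hp (Nat.pos_of_mul_pos_left hN.pos) (Dvd.intro _ rfl) hk)).resolve_left
    (hN.not_forall_dvd hp hk)

/-- The class of odd numerators is stable under sign, so its exponential sum is twice a cosine
subsum, which vanishes. It is nonempty by minimality of N, hence everything. -/
theorem IrreducibleCos.odd_of_four_dvd {n : ℕ} {φ : Fin n → ℚ} (hφ : IrreducibleCos φ) {N : ℕ}
    (hN : IsMinimalDenominator φ N) (hd : 4 ∣ N) {k : Fin n → ℤ} (hk : ∀ j, φ j * N = k j) (i) :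
    ¬ (2 : ℤ) ∣ k i := by
  obtain ⟨M', rfl⟩ := hd
  rw [show 4 * M' = 2 * (2 * M') by ring] at hN hk
  have h := hφ.sum_filter Nat.prime_two (Nat.pos_of_mul_pos_left hN.pos) (Dvd.intro _ rfl) hk 1
  have h0 := sum_cosRat_of_sum_expRat h
  have heq : (Finset.univ.filter fun j => ((2 : ℕ) : ℤ) ∣ -k j - 1) =
      Finset.univ.filter fun j => ((2 : ℕ) : ℤ) ∣ k j - 1 :=
    Finset.filter_congr fun j _ => by push_cast; omega
  rw [heq, ← two_mul, mul_eq_zero] at h0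
  have h0 := h0.resolve_left two_ne_zero
  have hne : (Finset.univ.filter fun j => ((2 : ℕ) : ℤ) ∣ k j - 1).Nonempty := by
    by_contra hemp
    rw [Finset.not_nonempty_iff_eq_empty, Finset.filter_eq_empty_iff] at hemp
    refine hN.not_forall_dvd Nat.prime_two hk fun j => ?_
    have := hemp (Finset.mem_univ j)
    push_cast at this ⊢
    omega
  have := Finset.mem_univ i
  rw [← hφ.eq_univ hne h0] at this
  have := (Finset.mem_filter.1 this).2
  push_cast at this
  omega

theorem expRat_quarter_mul {k : ℤ} (hk : ¬ (2 : ℤ) ∣ k) :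
    expRat (k / 4) = if k % 4 = 1 then expRat (1 / 4) else -expRat (1 / 4) := by
  have h1 : (k : ℚ) = 4 * (k / 4 : ℤ) + (k % 4 : ℤ) := by
    exact_mod_cast (Int.mul_ediv_add_emod k 4).symm
  split_ifs with h
  · rw [h] at h1
    exact expRat_eq_iff.2 ⟨k / 4, by rw [h1]; push_cast; ring⟩
  · have h3 : k % 4 = 3 := by omega
    rw [h3] at h1
    rw [← expRat_add_half]
    exact expRat_eq_iff.2 ⟨k / 4, by rw [h1]; push_cast; ring⟩

/-- With N = 8M, conjugation by 1 + 2M multiplies a term with odd numerator k by e(k/4) = ±i, with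
opposite signs for φⱼ and -φⱼ. Adding i times the original relation cancels one of the two and
leaves 2i times the sum of the e(ψⱼ), the sign being chosen by k modulo 4. -/
theorem IrreducibleCos.isListedCos_of_eight_dvd {n : ℕ} (h1 : 1 ≤ n) (h6 : n ≤ 6)
    {φ : Fin n → ℚ} (hφ : IrreducibleCos φ) {N : ℕ} (hN : IsMinimalDenominator φ N)
    (hd : 8 ∣ N) : IsListedCos φ := by
  choose k hk using hN.exists_int
  have hodd := hφ.odd_of_four_dvd hN ((by norm_num : 4 ∣ 8).trans hd) hk
  obtain ⟨M, rfl⟩ := hd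
  have hM : (M : ℚ) ≠ 0 := by
    have := Nat.pos_of_mul_pos_left hN.pos
    exact_mod_cast this.ne'
  have hcop : (1 + 2 * M).Coprime (8 * M) := by
    have h2 : (1 + 2 * M).Coprime (2 * M) := by simp
    have h8 : (1 + 2 * M).Coprime 2 := h2.coprime_mul_right_right
    have := h2.mul_right (h8.mul_right h8)
    rwa [show 2 * M * (2 * 2) = 8 * M by ring] at this
  have hs := hφ.sum_expRat
  have ht := sum_expRat_mul_eq_zero Finset.univ hN.pos (Sum.elim φ (-φ)) (by
    rintro (j | j)
    · exact ⟨k j, hk j⟩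
    · exact ⟨-k j, by simp only [Sum.elim_inr, Pi.neg_apply, neg_mul, hk j, Int.cast_neg]⟩)
    hs hcop
  rw [Fintype.sum_sum_type, ← Finset.sum_add_distrib] at hs ht
  refine hφ.isListedCos_of_sum_expRat h1 h6 (ψ := fun j => if k j % 4 = 1 then φ j else -φ j)
    (fun j => ?_) ?_
  · split_ifs
    · rfl
    · rw [cosRat_neg]
  · have h2 : 2 * expRat (1 / 4) ≠ 0 := mul_ne_zero two_ne_zero (expRat_ne_zero _)
    refine (mul_eq_zero.1 ?_).resolve_left h2
    refine Eq.trans ?_ (show expRat (1 / 4) * 0 + 0 = (0 : ℂ) by rw [mul_zero, add_zero])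
    rw [← congrArg (expRat (1 / 4) * ·) hs, ← ht, Finset.mul_sum, Finset.mul_sum,
      ← Finset.sum_add_distrib]
    refine Finset.sum_congr rfl fun j _ => ?_
    have e1 : ((1 + 2 * M : ℕ) : ℚ) * φ j = φ j + (k j : ℤ) / 4 := by
      rw [← hk j]; push_cast; field_simp; ring
    have e2 : ((1 + 2 * M : ℕ) : ℚ) * -φ j = -φ j + ((-k j : ℤ) : ℚ) / 4 := by
      rw [mul_neg, e1]; push_cast; ring
    have hk1 := expRat_quarter_mul (hodd j)
    have hk2 := expRat_quarter_mul (k := -k j) (by rw [dvd_neg]; exact hodd j)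
    have hj := hodd j
    simp only [Sum.elim_inl, Sum.elim_inr, Pi.neg_apply]
    rw [e1, e2, expRat_add, expRat_add, hk1, hk2]
    by_cases h : k j % 4 = 1
    · rw [if_pos h, if_pos h, if_neg (by omega)]; ring
    · rw [if_neg h, if_neg h, if_pos (by omega)]; ring

/-! ### Odd primes that divide the denominator exactly once. -/

/-- The angles are written as `φⱼ = aⱼ/p + bⱼ` with `0 ≤ aⱼ < p/2`, and the components of the sum
of the numbers `2 cos (2πφⱼ)` along the `p`-th roots of unity are all equal to `α`. -/
structure IsPrimeSplitting {n : ℕ} (p : ℕ) (φ : Fin n → ℚ) (a : Fin n → ℕ) (b : Fin n → ℚ)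
    (α : ℂ) : Prop where
  eq_add : ∀ j, φ j = a j / p + b j
  lt : ∀ j, 2 * a j < p
  sum_class : ∀ c : ℕ, 1 ≤ c → 2 * c < p → ∑ j with a j = c, expRat (b j) = α
  sum_zero : ∑ j with a j = 0, 2 * (cosRat (b j) : ℂ) = α

/-- A shift by 1/2 negates every cosine and α; it reduces α = -1 to α = 1. -/
theorem IsPrimeSplitting.neg {n p : ℕ} {φ : Fin n → ℚ} {a : Fin n → ℕ} {b : Fin n → ℚ} {α : ℂ}
    (h : IsPrimeSplitting p φ a b α) :
    IsPrimeSplitting p (fun j => φ j + 1 / 2) a (fun j => b j + 1 / 2) (-α) where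
  eq_add j := by rw [h.eq_add]; ring
  lt := h.lt
  sum_class c h1 h2 := by
    rw [← h.sum_class c h1 h2, ← Finset.sum_neg_distrib]
    simp only [expRat_add_half]
  sum_zero := by
    rw [← h.sum_zero, ← Finset.sum_neg_distrib]
    simp only [cosRat_add_half, Complex.ofReal_neg, mul_neg]

theorem IsPrimeSplitting.exists_class {n p : ℕ} {φ : Fin n → ℚ} {a : Fin n → ℕ} {b : Fin n → ℚ}
    {α : ℂ} (h : IsPrimeSplitting p φ a b α) (hα : α ≠ 0) {c : ℕ} (hc : 2 * c < p) :
    ∃ j, a j = c := by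
  by_contra! hcon
  rcases Nat.eq_zero_or_pos c with rfl | hpos
  · rw [← h.sum_zero, Finset.filter_false_of_mem fun j _ => hcon j] at hα
    exact hα rfl
  · rw [← h.sum_class c hpos hc, Finset.filter_false_of_mem fun j _ => hcon j] at hα
    exact hα rfl

/-- The zero class is stable under sign, so its component, and with it α, is real. -/
theorem IsPrimeSplitting.conj_eq {n p : ℕ} {φ : Fin n → ℚ} {a : Fin n → ℕ} {b : Fin n → ℚ}
    {α : ℂ} (h : IsPrimeSplitting p φ a b α) : (starRingEnd ℂ) α = α := by
  rw [← h.sum_zero, map_sum]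
  refine Finset.sum_congr rfl fun j _ => ?_
  rw [map_mul, Complex.conj_ofReal, map_ofNat]

theorem eq_one_or_neg_one_of_conj_eq {u : ℚ}
    (h : (starRingEnd ℂ) (expRat u) = expRat u) : expRat u = 1 ∨ expRat u = -1 := by
  rw [← mul_self_eq_one_iff]
  rw [conj_expRat] at h
  have := expRat_mul_neg u
  rwa [h] at this

/-- Up to sign, a rational number with denominator `pM` can be written as `a/p + b` with
`0 ≤ a < p/2`. -/
theorem exists_sign_eq_div_add {p M : ℕ} (hp : p.Prime) (hp2 : p ≠ 2) (hM : 0 < M)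
    (h : p.Coprime M) {x : ℚ} (hx : ∃ k : ℤ, x * (p * M : ℕ) = k) :
    ∃ (y : ℚ) (a : ℕ) (b : ℚ), (y = x ∨ y = -x) ∧ y = a / p + b ∧ 2 * a < p ∧
      ∃ k : ℤ, b * M = k := by
  obtain ⟨A, B, hAB, k, hk⟩ := exists_eq_div_add hp.pos hM h hx
  have hp0 : (p : ℚ) ≠ 0 := by exact_mod_cast hp.ne_zero
  have hpZ : (0 : ℤ) < p := by exact_mod_cast hp.pos
  have hA : (A : ℚ) = p * (A / p : ℤ) + (A % p : ℤ) := by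
    exact_mod_cast (Int.mul_ediv_add_emod A p).symm
  have hr0 := Int.emod_nonneg A hpZ.ne'
  have hr1 := Int.emod_lt_of_pos A hpZ
  generalize A / p = q at hA
  generalize A % p = r at hA hr0 hr1
  lift r to ℕ using hr0
  have hodd : p % 2 = 1 := hp.eq_two_or_odd.resolve_left hp2
  by_cases hr : 2 * r < p
  · refine ⟨x, r, B + q, Or.inl rfl, ?_, hr, k + q * M, ?_⟩
    · rw [hAB, hA]; push_cast; field_simp; ring
    · rw [add_mul, hk]; push_cast; ring
  -- A residue r > p/2 becomes p - r after changing the sign; the -1 compensates p/p.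
  · refine ⟨-x, p - r, -B - q - 1, Or.inr rfl, ?_, by omega, -k - q * M - M, ?_⟩
    · rw [hAB, hA, Nat.cast_sub (by omega)]; push_cast; field_simp; ring
    · rw [sub_mul, sub_mul, neg_mul, hk]; push_cast; ring

/-- If the prime `p` divides the denominator exactly once, then an irreducible solution of the
cosine equation is listed or has a splitting with nonzero components. -/
theorem IrreducibleCos.exists_isPrimeSplitting {n : ℕ} (h1 : 1 ≤ n) (h6 : n ≤ 6)
    {φ : Fin n → ℚ} (hφ : IrreducibleCos φ) {p M : ℕ} (hN : IsMinimalDenominator φ (p * M))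
    (hp : p.Prime) (hp2 : p ≠ 2) (hpM : ¬ p ∣ M) :
    IsListedCos φ ∨ ∃ (ψ : Fin n → ℚ) (a : Fin n → ℕ) (b : Fin n → ℚ) (α : ℂ),
      (∀ j, ψ j = φ j ∨ ψ j = -φ j) ∧ (∀ j, ∃ k : ℤ, b j * M = k) ∧ α ≠ 0 ∧
      IsPrimeSplitting p ψ a b α := by
  have hM : 0 < M := Nat.pos_of_mul_pos_left hN.pos
  have hp0 : (p : ℚ) ≠ 0 := by exact_mod_cast hp.ne_zero
  have hpC : (p : ℂ) ≠ 0 := by exact_mod_cast hp.ne_zero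
  have hcop : p.Coprime M := (Nat.Prime.coprime_iff_not_dvd hp).2 hpM
  choose ψ a b hψ hab hlt hb using fun j => exists_sign_eq_div_add hp hp2 hM hcop (hN.exists_int j)
  have hcos : ∀ j, cosRat (ψ j) = cosRat (φ j) := fun j => by
    rcases hψ j with h | h
    · rw [h]
    · rw [h, cosRat_neg]
  have hirr : IrreducibleCos ψ := hφ.congr hcos
  set α : ℂ := (p : ℂ)⁻¹ * ∑ i, expRat (Sum.elim b (-b) i) with hαdef
  have hclass : ∀ c : ℤ, ∑ j with (p : ℤ) ∣ (a j : ℤ) - c, expRat (b j) +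
      ∑ j with (p : ℤ) ∣ -(a j : ℤ) - c, expRat (-b j) = α := fun c => by
    have hsum := hirr.sum_expRat
    have hsum' : ∑ i, expRat ((Sum.elim (fun j => (a j : ℤ)) (-fun j => (a j : ℤ)) i : ℤ) / p +
        Sum.elim b (-b) i) = 0 := by
      rw [← hsum]
      refine Finset.sum_congr rfl fun i _ => ?_
      rcases i with j | j
      · simp only [Sum.elim_inl, hab]; congr 1
      · simp only [Sum.elim_inr, Pi.neg_apply, hab]; congr 1; push_cast; ring
    have := sum_expRat_filter_eq Finset.univ hp hM hpM _ _ (by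
      rintro (j | j)
      · exact hb j
      · obtain ⟨k, hk⟩ := hb j
        exact ⟨-k, by simp only [Sum.elim_inr, Pi.neg_apply, neg_mul, hk, Int.cast_neg]⟩) hsum' c
    rw [sum_filter_sum_elim (fun x => (p : ℤ) ∣ x - c) (fun j => (a j : ℤ)) expRat b] at this
    rw [hαdef, ← this, inv_mul_cancel_left₀ hpC]
  -- If the common component is zero, each class vanishes separately after multiplication by e(c/p),
  -- so `IrreducibleCos.isListedCos_of_classes` applies; its exceptional case, all aⱼ zero,
  -- contradicts minimality of the denominator.
  by_cases hα : α = 0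
  · left
    have hroot : ∀ (x : ℤ) (c : ℤ), (p : ℤ) ∣ x - c → expRat (x / p) = expRat (c / p) := by
      rintro x c ⟨m, hm⟩
      refine expRat_eq_iff.2 ⟨m, ?_⟩
      have : (x : ℚ) = c + p * m := by
        have : x = c + p * m := by linarith
        exact_mod_cast this
      rw [this]; field_simp
    have h := hirr.isListedCos_of_classes h1 h6 hp hp2 (k := fun j => (a j : ℤ)) fun c => by
      rw [← mul_zero (expRat (c / p)), ← hα, ← hclass c, mul_add, Finset.mul_sum, Finset.mul_sum]
      congr 1
      · refine Finset.sum_congr rfl fun j hj => ?_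
        rw [← hroot _ _ (Finset.mem_filter.1 hj).2, ← expRat_add, hab]
        congr 1
      · refine Finset.sum_congr rfl fun j hj => ?_
        rw [← hroot _ _ (Finset.mem_filter.1 hj).2, ← expRat_add, hab]
        congr 1; push_cast; ring
    rcases h with h | h
    · exfalso
      refine hN.minimal M hM (lt_mul_of_one_lt_left hM hp.one_lt) fun j => ?_
      have ha : a j = 0 := by
        have h2 : p ∣ a j := by exact_mod_cast h j
        by_contra h0
        have := Nat.le_of_dvd (Nat.pos_of_ne_zero h0) h2
        have := hlt j
        omega
      obtain ⟨k, hk⟩ := hb j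
      have h3 : ψ j = b j := by rw [hab, ha]; simp
      rcases hψ j with h | h
      · exact ⟨k, by rw [← h, h3, hk]⟩
      · exact ⟨-k, by rw [← neg_neg (φ j), ← h, h3, neg_mul, hk]; push_cast; rfl⟩
    · exact h.congr hcos
  -- Since all aⱼ lie below p/2, no -aⱼ falls in a class c with 1 ≤ c < p/2, whereas both signs fall
  -- in class 0, where they combine to twice a cosine.
  · refine Or.inr ⟨ψ, a, b, α, hψ, hb, hα, hab, hlt, fun c hc1 hc2 => ?_, ?_⟩
    · rw [← hclass c, Finset.filter_false_of_mem (p := fun j => (p : ℤ) ∣ -(a j : ℤ) - c),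
        Finset.sum_empty, add_zero]
      · refine Finset.sum_congr (Finset.filter_congr fun j _ => ⟨fun h => by simp [h], fun h => ?_⟩)
          fun _ _ => rfl
        have := Int.eq_zero_of_abs_lt_dvd h (by have := hlt j; rw [abs_lt]; omega)
        omega
      · intro j _ h
        have := Int.eq_zero_of_abs_lt_dvd h (by have := hlt j; rw [abs_lt]; omega)
        omega
    · have h3 : ∀ j, (p : ℤ) ∣ (a j : ℤ) ↔ a j = 0 := fun j => ⟨fun h => by
        have := Int.eq_zero_of_abs_lt_dvd h (by have := hlt j; rw [abs_lt]; omega)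
        omega, fun h => by simp [h]⟩
      rw [← hclass 0]
      simp only [sub_zero, dvd_neg, h3, ← Finset.sum_add_distrib, expRat_add_expRat_neg]

theorem cosRat_add_of_expRat_eq {x b z : ℚ} (h : expRat b = expRat z) :
    cosRat (x + b) = cosRat (x + z) := by
  rw [← expRat_re, ← expRat_re, expRat_add, expRat_add, h]

/-- Each of the classes 0, …, (p-1)/2 contains a term because α is nonzero. -/
theorem IsPrimeSplitting.half_le {n p : ℕ} {φ : Fin n → ℚ} {a : Fin n → ℕ} {b : Fin n → ℚ}
    {α : ℂ} (h : IsPrimeSplitting p φ a b α) (hα : α ≠ 0) : (p + 1) / 2 ≤ n := by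
  have hsub : Finset.range ((p + 1) / 2) ⊆ Finset.univ.image a := fun c hc => by
    obtain ⟨j, hj⟩ := h.exists_class hα (c := c) (by have := Finset.mem_range.1 hc; omega)
    exact Finset.mem_image.2 ⟨j, Finset.mem_univ j, hj⟩
  have h1 := Finset.card_le_card hsub
  have h2 := Finset.card_image_le (s := Finset.univ) (f := a)
  simp only [Finset.card_range, Finset.card_univ, Fintype.card_fin] at h1 h2
  omega

theorem cosMultiset_eq_sum_class {n m : ℕ} {φ : Fin n → ℚ} {a : Fin n → ℕ} (h : ∀ j, a j < m) :
    cosMultiset φ = ∑ c ∈ Finset.range m, ∑ j with a j = c, {cosRat (φ j)} :=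
  (Finset.sum_fiberwise_of_maps_to (fun j _ => Finset.mem_range.2 (h j)) _).symm

theorem card_eq_sum_class {n m : ℕ} {a : Fin n → ℕ} (h : ∀ j, a j < m) :
    n = ∑ c ∈ Finset.range m, (Finset.univ.filter fun j => a j = c).card := by
  have := Finset.card_eq_sum_card_fiberwise (s := (Finset.univ : Finset (Fin n)))
    (t := Finset.range m) (f := a) (fun j _ => by simpa using h j)
  simpa using this

/-! ### The prime 11, and the exclusion of larger primes. -/

/-- Six occupied classes and at most six terms make every class a singleton. Then e(b) = 1 in the
classes 1 to 5 and 2 cos 2πb = 1 in class 0. -/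
theorem IsPrimeSplitting.isListedCos_eleven {n : ℕ} (h6 : n ≤ 6) {φ : Fin n → ℚ}
    {a : Fin n → ℕ} {b : Fin n → ℚ} (h : IsPrimeSplitting 11 φ a b 1) : IsListedCos φ := by
  have hlt : ∀ j, a j < 6 := fun j => by have := h.lt j; omega
  have hn := card_eq_sum_class hlt
  have hpos : ∀ c, 2 * c < 11 → 1 ≤ (Finset.univ.filter fun j => a j = c).card := fun c hc => by
    obtain ⟨j, hj⟩ := h.exists_class one_ne_zero hc
    exact Finset.card_pos.2 ⟨j, by simp [hj]⟩
  have hsum := cosMultiset_eq_sum_class (φ := φ) hlt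
  have h0 : ∀ c, 1 ≤ c → 2 * c < 11 → (Finset.univ.filter fun j => a j = c).card = 1 →
      ∑ j with a j = c, ({cosRat (φ j)} : Multiset ℝ) = {cosRat (c / 11)} := by
    intro c h1 h2 h3
    obtain ⟨j, hj⟩ := Finset.card_eq_one.1 h3
    have h4 := h.sum_class c h1 h2
    rw [hj, Finset.sum_singleton, ← expRat_zero] at h4
    have hc : a j = c := by
      have := Finset.mem_singleton_self j
      rw [← hj] at this
      exact (Finset.mem_filter.1 this).2
    rw [hj, Finset.sum_singleton, h.eq_add, hc, cosRat_add_of_expRat_eq h4, add_zero]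
    norm_num
  have hz : (Finset.univ.filter fun j => a j = 0).card = 1 →
      ∑ j with a j = 0, ({cosRat (φ j)} : Multiset ℝ) = {cosRat (1 / 6)} := by
    intro h3
    obtain ⟨j, hj⟩ := Finset.card_eq_one.1 h3
    have h4 := h.sum_zero
    rw [hj, Finset.sum_singleton] at h4
    have h5 : 2 * cosRat (b j) = 1 := by exact_mod_cast h4
    have hc : a j = 0 := by
      have := Finset.mem_singleton_self j
      rw [← hj] at this
      exact (Finset.mem_filter.1 this).2
    rw [hj, Finset.sum_singleton, h.eq_add, hc, cosRat_sixth, Nat.cast_zero, zero_div, zero_add]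
    congr 1; linarith
  have p0 := hpos 0 (by norm_num)
  have p1 := hpos 1 (by norm_num)
  have p2 := hpos 2 (by norm_num)
  have p3 := hpos 3 (by norm_num)
  have p4 := hpos 4 (by norm_num)
  have p5 := hpos 5 (by norm_num)
  simp only [Finset.sum_range_succ, Finset.sum_range_zero, zero_add] at hn hsum
  rw [hz (by omega), h0 1 (by norm_num) (by norm_num) (by omega),
    h0 2 (by norm_num) (by norm_num) (by omega), h0 3 (by norm_num) (by norm_num) (by omega),
    h0 4 (by norm_num) (by norm_num) (by omega), h0 5 (by norm_num) (by norm_num) (by omega)]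
    at hsum
  obtain rfl : n = 6 := by omega
  refine ⟨![1 / 11, 2 / 11, 3 / 11, 4 / 11, 5 / 11, 1 / 6], Or.inl (by simp [cosSporadic]),
    cosEquiv_iff.2 (Or.inl ?_)⟩
  rw [hsum]
  simp only [cosMultiset, Fin.sum_univ_six, Matrix.cons_val]
  push_cast
  abel

/-- If a single class is represented once, then the components are `1` or `-1`. -/
theorem IsPrimeSplitting.eq_one_or_neg_one {n p : ℕ} {φ : Fin n → ℚ} {a : Fin n → ℕ}
    {b : Fin n → ℚ} {α : ℂ} (h : IsPrimeSplitting p φ a b α) {c : ℕ} (h1 : 1 ≤ c)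
    (h2 : 2 * c < p) (hc : (Finset.univ.filter fun j => a j = c).card = 1) : α = 1 ∨ α = -1 := by
  obtain ⟨j, hj⟩ := Finset.card_eq_one.1 hc
  have h3 := h.sum_class c h1 h2
  rw [hj, Finset.sum_singleton] at h3
  have h4 := h.conj_eq
  rw [← h3] at h4 ⊢
  exact eq_one_or_neg_one_of_conj_eq h4

theorem IrreducibleCos.isListedCos_of_large_prime_dvd {n : ℕ} (h1 : 1 ≤ n) (h6 : n ≤ 6)
    {φ : Fin n → ℚ} (hφ : IrreducibleCos φ) {p M : ℕ} (hN : IsMinimalDenominator φ (p * M))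
    (hp : p.Prime) (hp11 : 11 ≤ p) (hpM : ¬ p ∣ M) : IsListedCos φ := by
  rcases hφ.exists_isPrimeSplitting h1 h6 hN hp (by omega) hpM with
    h | ⟨ψ, a, b, α, hψ, -, hα, h⟩
  · exact h
  have hcos : ∀ j, cosRat (ψ j) = cosRat (φ j) := fun j => by
    rcases hψ j with h | h
    · rw [h]
    · rw [h, cosRat_neg]
  have hle := h.half_le hα
  have hp12 : p < 13 := by omega
  obtain rfl : p = 11 := by
    interval_cases p
    · rfl
    · exact absurd hp (by norm_num)
  have hlt : ∀ j, a j < 6 := fun j => by have := h.lt j; omega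
  have hn := card_eq_sum_class hlt
  have hpos : ∀ c, 2 * c < 11 → 1 ≤ (Finset.univ.filter fun j => a j = c).card := fun c hc => by
    obtain ⟨j, hj⟩ := h.exists_class hα hc
    exact Finset.card_pos.2 ⟨j, by simp [hj]⟩
  have p0 := hpos 0 (by norm_num)
  have p1 := hpos 1 (by norm_num)
  have p2 := hpos 2 (by norm_num)
  have p3 := hpos 3 (by norm_num)
  have p4 := hpos 4 (by norm_num)
  have p5 := hpos 5 (by norm_num)
  simp only [Finset.sum_range_succ, Finset.sum_range_zero, zero_add] at hn
  rcases h.eq_one_or_neg_one (c := 1) (by norm_num) (by norm_num) (by omega) with rfl | rfl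
  · exact (h.isListedCos_eleven h6).congr hcos
  · have h' := h.neg
    rw [neg_neg] at h'
    exact (h'.isListedCos_eleven h6).neg fun j => by rw [cosRat_add_half, hcos]

/-! ### The prime 7. -/

/-- Numerators over `60` of the minimal solutions of `∑ cos = 1/2` with at most three terms. -/
def halfSolutions : List (List ℕ) :=
  [[10], [6, 18], [0, 20], [4, 16, 18], [0, 12, 24], [6, 8, 28]]

/-- The list contains a short solution of the cosine equation or solves `∑ cos = 1/2`. -/
def isReducibleOrHalf (l : List ℕ) : Bool :=
  (shortSolutions.any fun b => isSubmultiset b l) || halfSolutions.any fun a => l.isPerm a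

theorem checkSums_half :
    ((List.range 3).all fun n => checkSums 9241 isReducibleOrHalf (n + 1)
      (evenResidues ++ oddResidues) (cosResidue (77 * 20)) []) = true := by
  decide +kernel

theorem exists_halfSolution {ι : Type*} [Fintype ι] (h1 : 1 ≤ Fintype.card ι)
    (h3 : Fintype.card ι ≤ 3) {x : ι → ℚ} (K : ι → ℤ) (hK : ∀ i, x i * 60 = K i)
    (hsum : ∑ i, cosRat (x i) = 1 / 2)
    (hirr : ∀ E : Finset ι, E.Nonempty → ∑ i ∈ E, cosRat (x i) ≠ 0) :
    ∃ l ∈ halfSolutions, ∑ i, ({cosRat (x i)} : Multiset ℝ) =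
      (l.map fun k : ℕ => cosRat (k / 60) : List ℝ) := by
  set k : ι → ℕ := fun j => foldSixty (K j % 60).toNat with hkdef
  have hk : ∀ j, cosRat (x j) = cosRat (k j / 60) := fun j => by
    rw [hkdef, exists_foldSixty, ← hK j]; congr 1; ring
  have hr : (cosResidue (77 * 20) +
      ((∑ j, ({k j} : Multiset ℕ)).map fun x : ℕ => cosResidue (77 * x)).sum) % 9241 = 0 := by
    rw [map_sum_singleton, sum_singleton_eq_map]
    -- The additional index carries the numerator 20, since cos(2π/3) = -1/2 makes the equation
    -- homogeneous. Its residue is the initial value of the search.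
    have h := sum_cosResidue_of_sum_cosRat Finset.univ (fun o : Option ι => o.elim 20 k) (by
      rw [Fintype.sum_option]
      simp only [Option.elim, ← hk, hsum]
      have := cosRat_third
      norm_num at this ⊢
      rw [this]; norm_num)
    rw [Fintype.sum_option] at h
    exact h
  have hc := checkSums_half
  rw [List.all_eq_true] at hc
  have hc := hc (Fintype.card ι - 1) (List.mem_range.2 (by omega))
  rw [Nat.sub_add_cancel h1] at hc
  obtain ⟨l, hl, hg⟩ := exists_good_of_checkSums (fun x : ℕ => cosResidue (77 * x)) _ _ _ []
    (by decide +kernel) hc (∑ j, {k j}) (by simp) (fun y hy => by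
      rw [sum_singleton_eq_map, Multiset.mem_map] at hy
      obtain ⟨j, -, rfl⟩ := hy
      have h3 : k j ≤ 30 := foldSixty_le _
      generalize k j = y at h3
      have : ∀ y ≤ 30, y ∈ (evenResidues ++ oddResidues).map Prod.fst := by decide
      exact this y h3) hr
  rw [Multiset.coe_nil, add_zero] at hl
  simp only [isReducibleOrHalf, Bool.or_eq_true, List.any_eq_true] at hg
  rcases hg with ⟨b, hb, hg⟩ | ⟨a, ha, hg⟩
  · obtain ⟨E, -, hne, h0⟩ := exists_sum_eq_zero_of_shortSolution hk hl hb hg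
    exact absurd h0 (hirr E hne)
  · refine ⟨a, ha, ?_⟩
    rw [← Multiset.map_coe, ← Multiset.coe_eq_coe.2 (List.isPerm_iff.1 hg), hl, map_sum_singleton]
    simp only [hk]

/-- The representative in `[0, 1/2]` of a rational number modulo `1` and sign. -/
def foldRat (x : ℚ) : ℚ := min (x - x.floor) (1 - (x - x.floor))

theorem cosRat_foldRat (x : ℚ) : cosRat (foldRat x) = cosRat x := by
  rw [foldRat]
  rcases min_choice (x - x.floor) (1 - (x - x.floor)) with h | h <;> rw [h, cosRat_eq_iff]
  · exact ⟨-x.floor, Or.inl (by push_cast; ring)⟩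
  · exact ⟨x.floor + 1, Or.inr (by push_cast; ring)⟩

/-- The angles of a class `c` modulo `7` that consists of one or two terms. -/
def classAngles (c : ℚ) : List (List ℚ) := [[c / 7], [c / 7 + 1 / 6, c / 7 - 1 / 6]]

/-- Every combination of admissible classes with at most six terms is in the sporadic list; angles
are compared by their folded rational representatives, so the check is exact. -/
theorem exists_sporadic_seven :
    ∀ l₀ ∈ halfSolutions, ∀ l₁ ∈ classAngles 1, ∀ l₂ ∈ classAngles 2, ∀ l₃ ∈ classAngles 3,
      (l₀.map (fun k : ℕ => (k / 60 : ℚ)) ++ (l₁ ++ (l₂ ++ l₃))).length ≤ 6 →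
      ∃ ψ ∈ cosSporadic (l₀.map (fun k : ℕ => (k / 60 : ℚ)) ++ (l₁ ++ (l₂ ++ l₃))).length,
        ((List.ofFn ψ).map foldRat).isPerm
          ((l₀.map (fun k : ℕ => (k / 60 : ℚ)) ++ (l₁ ++ (l₂ ++ l₃))).map foldRat) = true := by
  decide +kernel

theorem cosMultiset_eq_of_foldRat_isPerm {n : ℕ} {ψ : Fin n → ℚ} {l : List ℚ}
    (h : ((List.ofFn ψ).map foldRat).isPerm (l.map foldRat) = true) :
    cosMultiset ψ = (l.map cosRat : List ℝ) := by
  have h1 := (List.isPerm_iff.1 h).map cosRat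
  simp only [List.map_map, Function.comp_def, cosRat_foldRat] at h1
  rw [← Multiset.coe_eq_coe.2 h1, List.map_ofFn, cosMultiset, sum_singleton_eq_map,
    Fin.univ_val_map]
  rfl

theorem IsPrimeSplitting.exists_classAngles {n : ℕ} {φ : Fin n → ℚ} (hφ : IrreducibleCos φ)
    {a : Fin n → ℕ} {b : Fin n → ℚ} (h : IsPrimeSplitting 7 φ a b 1) (hn : 4 ≤ n) {c : ℕ}
    (h1 : 1 ≤ c) (h2 : 2 * c < 7)
    (hc : (Finset.univ.filter fun j => a j = c).card ≤ 3) :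
    ∃ l ∈ classAngles c, (Finset.univ.filter fun j => a j = c).card = l.length ∧
      ∑ j with a j = c, ({cosRat (φ j)} : Multiset ℝ) = (l.map cosRat : List ℝ) := by
  have hpos : 0 < (Finset.univ.filter fun j => a j = c).card := by
    obtain ⟨j, hj⟩ := h.exists_class one_ne_zero h2
    exact Finset.card_pos.2 ⟨j, by simp [hj]⟩
  have hsum := h.sum_class c h1 h2
  have hmem : ∀ j ∈ Finset.univ.filter fun j => a j = c, φ j = c / 7 + b j := fun j hj => by
    rw [h.eq_add, (Finset.mem_filter.1 hj).2]; rfl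
  have hcases : (Finset.univ.filter fun j => a j = c).card = 1 ∨
      (Finset.univ.filter fun j => a j = c).card = 2 ∨
      (Finset.univ.filter fun j => a j = c).card = 3 := by omega
  generalize (Finset.univ.filter fun j => a j = c) = S at *
  rcases hcases with hS | hS | hS
  · obtain ⟨j, rfl⟩ := Finset.card_eq_one.1 hS
    rw [Finset.sum_singleton, ← expRat_zero] at hsum
    refine ⟨[c / 7], by simp [classAngles], by simp, ?_⟩
    rw [Finset.sum_singleton, hmem j (by simp), cosRat_add_of_expRat_eq hsum, add_zero]
    rfl
  · obtain ⟨i, j, hij, rfl⟩ := Finset.card_eq_two.1 hS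
    rw [Finset.sum_pair hij] at hsum
    refine ⟨[c / 7 + 1 / 6, c / 7 - 1 / 6], by simp [classAngles], by simpa using hS, ?_⟩
    rw [Finset.sum_pair hij, hmem i (by simp), hmem j (by simp)]
    rcases expRat_add_eq_one hsum with ⟨g1, g2⟩ | ⟨g1, g2⟩
    · rw [cosRat_add_of_expRat_eq g1, cosRat_add_of_expRat_eq g2, ← sub_eq_add_neg]; rfl
    · rw [cosRat_add_of_expRat_eq g1, cosRat_add_of_expRat_eq g2, ← sub_eq_add_neg, add_comm]; rfl
  -- Three roots of unity with sum 1 contain an antipodal pair. Within a class the two angles share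
  -- the summand c/7, so their cosines cancel, and n ≥ 4 makes this a proper subsum.
  · exfalso
    obtain ⟨i, j, k, hij, hik, hjk, rfl⟩ := Finset.card_eq_three.1 hS
    have hcancel : ∀ x y, x ≠ y → x ∈ ({i, j, k} : Finset (Fin n)) →
        y ∈ ({i, j, k} : Finset (Fin n)) → expRat (b x) + expRat (b y) ≠ 0 := by
      intro x y hxy hx hy h0
      have h3 : ∑ z ∈ {x, y}, cosRat (φ z) = 0 := by
        rw [Finset.sum_pair hxy, ← expRat_re, ← expRat_re, ← Complex.add_re, hmem x hx, hmem y hy,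
          expRat_add, expRat_add, ← mul_add, h0, mul_zero, Complex.zero_re]
      have h4 := congrArg Finset.card (hφ.eq_univ ⟨x, by simp⟩ h3)
      rw [Finset.card_pair hxy, Finset.card_univ, Fintype.card_fin] at h4
      omega
    rw [Finset.sum_insert (by simp [hij, hik]), Finset.sum_pair hjk, ← add_assoc] at hsum
    rcases expRat_add_add_eq_one hsum with h0 | h0 | h0
    · exact hcancel j k hjk (by simp) (by simp) h0
    · exact hcancel i k hik (by simp) (by simp) h0
    · exact hcancel i j hij (by simp) (by simp) h0

theorem IsPrimeSplitting.isListedCos_seven {n : ℕ} (h6 : n ≤ 6) {φ : Fin n → ℚ}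
    (hφ : IrreducibleCos φ) {a : Fin n → ℕ} {b : Fin n → ℚ} (h : IsPrimeSplitting 7 φ a b 1)
    (hb : ∀ j, ∃ k : ℤ, b j * 60 = k) : IsListedCos φ := by
  have hlt : ∀ j, a j < 4 := fun j => by have := h.lt j; omega
  have hn := card_eq_sum_class hlt
  have hsum := cosMultiset_eq_sum_class (φ := φ) hlt
  have hpos : ∀ c, 2 * c < 7 → 1 ≤ (Finset.univ.filter fun j => a j = c).card := fun c hc => by
    obtain ⟨j, hj⟩ := h.exists_class one_ne_zero hc
    exact Finset.card_pos.2 ⟨j, by simp [hj]⟩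
  have p0 := hpos 0 (by norm_num)
  have p1 := hpos 1 (by norm_num)
  have p2 := hpos 2 (by norm_num)
  have p3 := hpos 3 (by norm_num)
  simp only [Finset.sum_range_succ, Finset.sum_range_zero, zero_add] at hn hsum
  obtain ⟨l₁, hl₁, hc₁, hm₁⟩ := h.exists_classAngles hφ (by omega) (c := 1) le_rfl (by norm_num)
    (by omega)
  obtain ⟨l₂, hl₂, hc₂, hm₂⟩ := h.exists_classAngles hφ (by omega) (c := 2) (by norm_num)
    (by norm_num) (by omega)
  obtain ⟨l₃, hl₃, hc₃, hm₃⟩ := h.exists_classAngles hφ (by omega) (c := 3) (by norm_num)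
    (by norm_num) (by omega)
  have hzero : ∀ j : {j // a j = 0}, φ j = b j := fun j => by rw [h.eq_add, j.2]; simp
  have hcard0 : Fintype.card {j // a j = 0} = (Finset.univ.filter fun j => a j = 0).card :=
    Fintype.card_subtype _
  choose K hK using fun j : {j // a j = 0} => hb j
  -- Class 0 satisfies ∑ cos = 1/2 with at most three terms, and it has no vanishing subsum because
  -- other classes are occupied.
  obtain ⟨l₀, hl₀, hm₀⟩ := exists_halfSolution (x := fun j : {j // a j = 0} => φ j)
    (by omega) (by omega) K (fun j => by rw [hzero, hK]) (by
      have h5 := h.sum_zero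
      rw [← Finset.mul_sum, ← Complex.ofReal_sum] at h5
      have h6 : 2 * ∑ j with a j = 0, cosRat (b j) = 1 := by exact_mod_cast h5
      rw [Finset.sum_subtype (p := fun j => a j = 0) _ (by simp)] at h6
      simp only [hzero]
      linarith) (by
      intro E hE h0
      have h5 : ∑ j ∈ E.map (Function.Embedding.subtype _), cosRat (φ j) = 0 := by
        rw [Finset.sum_map]; exact h0
      have h6 := hφ.eq_univ (hE.map) h5
      have h7 := congrArg Finset.card h6
      rw [Finset.card_map, Finset.card_univ, Fintype.card_fin] at h7
      have h8 := Finset.card_le_univ E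
      omega)
  have hm₀' : ∑ j with a j = 0, ({cosRat (φ j)} : Multiset ℝ) =
      ((l₀.map (fun k : ℕ => (k / 60 : ℚ))).map cosRat : List ℝ) := by
    rw [Finset.sum_subtype (p := fun j => a j = 0) _ (by simp), hm₀, List.map_map]
    rfl
  have hc₀ : (Finset.univ.filter fun j => a j = 0).card = l₀.length := by
    have := congrArg Multiset.card hm₀
    simpa [hcard0] using this
  rw [hm₀', hm₁, hm₂, hm₃, Multiset.coe_add, Multiset.coe_add, Multiset.coe_add, ← List.map_append,
    ← List.map_append, ← List.map_append, List.append_assoc, List.append_assoc] at hsum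
  have hlen : (l₀.map (fun k : ℕ => (k / 60 : ℚ)) ++ (l₁ ++ (l₂ ++ l₃))).length = n := by
    simp only [List.length_append, List.length_map]; omega
  obtain ⟨ψ, hψ, hperm⟩ := exists_sporadic_seven l₀ hl₀ l₁ (by simpa using hl₁) l₂
    (by simpa using hl₂) l₃ (by simpa using hl₃) (by omega)
  subst hlen
  exact ⟨ψ, Or.inl hψ, cosEquiv_iff.2 (Or.inl (hsum.trans
    (cosMultiset_eq_of_foldRat_isPerm hperm).symm))⟩

theorem IrreducibleCos.isListedCos_of_seven_dvd {n : ℕ} (h1 : 1 ≤ n) (h6 : n ≤ 6)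
    {φ : Fin n → ℚ} (hφ : IrreducibleCos φ) {M : ℕ} (hN : IsMinimalDenominator φ (7 * M))
    (hM : M ∣ 60) : IsListedCos φ := by
  have hpM : ¬ 7 ∣ M := fun hd => absurd (hd.trans hM) (by norm_num)
  rcases hφ.exists_isPrimeSplitting h1 h6 hN (by norm_num) (by norm_num) hpM with
    h | ⟨ψ, a, b, α, hψ, hb, hα, h⟩
  · exact h
  have hcos : ∀ j, cosRat (ψ j) = cosRat (φ j) := fun j => by
    rcases hψ j with h | h
    · rw [h]
    · rw [h, cosRat_neg]
  have hb60 : ∀ j, ∃ k : ℤ, b j * 60 = k := fun j => by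
    obtain ⟨m, hm⟩ := hM
    obtain ⟨k, hk⟩ := hb j
    refine ⟨k * m, ?_⟩
    have : (60 : ℚ) = M * m := by exact_mod_cast hm
    rw [this, ← mul_assoc, hk]; push_cast; ring
  have hirr := hφ.congr hcos
  have hlt : ∀ j, a j < 4 := fun j => by have := h.lt j; omega
  have hn := card_eq_sum_class hlt
  have hpos : ∀ c, 2 * c < 7 → 1 ≤ (Finset.univ.filter fun j => a j = c).card := fun c hc => by
    obtain ⟨j, hj⟩ := h.exists_class hα hc
    exact Finset.card_pos.2 ⟨j, by simp [hj]⟩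
  have p0 := hpos 0 (by norm_num)
  have p1 := hpos 1 (by norm_num)
  have p2 := hpos 2 (by norm_num)
  have p3 := hpos 3 (by norm_num)
  simp only [Finset.sum_range_succ, Finset.sum_range_zero, zero_add] at hn
  -- One of the classes 1, 2, 3 is a singleton: otherwise there would be at least 1 + 2·3 = 7 terms.
  have hα1 : α = 1 ∨ α = -1 := by
    by_cases e1 : (Finset.univ.filter fun j => a j = 1).card = 1
    · exact h.eq_one_or_neg_one (by norm_num) (by norm_num) e1
    by_cases e2 : (Finset.univ.filter fun j => a j = 2).card = 1
    · exact h.eq_one_or_neg_one (by norm_num) (by norm_num) e2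
    · exact h.eq_one_or_neg_one (c := 3) (by norm_num) (by norm_num) (by omega)
  rcases hα1 with rfl | rfl
  · exact (h.isListedCos_seven h6 hirr hb60).congr hcos
  · have h' := h.neg
    rw [neg_neg] at h'
    refine (h'.isListedCos_seven h6 (hirr.neg fun j => cosRat_add_half _) fun j => ?_).neg
      fun j => by rw [cosRat_add_half, hcos]
    obtain ⟨k, hk⟩ := hb60 j
    exact ⟨k + 30, by rw [add_mul, hk]; push_cast; ring⟩

/-! ### Completeness of the cosine list. -/

/-- The irreducible solutions of the cosine equation with two to six terms are listed. -/
theorem IrreducibleCos.isListedCos {n : ℕ} (h2 : 2 ≤ n) (h6 : n ≤ 6) {φ : Fin n → ℚ}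
    (hφ : IrreducibleCos φ) : IsListedCos φ := by
  have h1 : 1 ≤ n := by omega
  by_contra hnot
  obtain ⟨N, hpos, hint, hmin⟩ := exists_minimal_denominator φ
  have hN : IsMinimalDenominator φ N := ⟨hpos, hint, hmin⟩
  have hsq : ∀ p : ℕ, p.Prime → p ≠ 2 → ¬ p * p ∣ N := fun p hp hp2 hd =>
    hnot (hφ.isListedCos_of_odd_sq_dvd h1 h6 hN hp hp2 hd)
  have h8 : ¬ 8 ∣ N := fun hd => hnot (hφ.isListedCos_of_eight_dvd h1 h6 hN hd)
  have hlarge : ∀ p : ℕ, p.Prime → p ∣ N → p ≤ 10 := fun p hp hd => by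
    by_contra! hlt
    obtain ⟨M, rfl⟩ := hd
    exact hnot (hφ.isListedCos_of_large_prime_dvd h1 h6 hN hp (by omega) fun hd =>
      hsq p hp (by omega) (Nat.mul_dvd_mul_left p hd))
  -- N is squarefree apart from a possible factor 4, so divisibility is tested on primes. This
  -- yields N | 420, and N | 60 if 7 does not divide N.
  have hdvd : ∀ K : ℕ, 4 ∣ K → (∀ p : ℕ, p.Prime → p ∣ N → p ∣ K) → N ∣ K := fun K hK4 hK => by
    rw [Nat.dvd_iff_prime_pow_dvd_dvd]
    intro p k hp hd
    rcases k with _ | _ | k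
    · simp
    · rw [zero_add, pow_one] at hd ⊢
      exact hK p hp hd
    · have hpp : p * p ∣ p ^ (k + 2) := by rw [pow_add, pow_two]; exact Dvd.intro_left _ rfl
      obtain rfl : p = 2 := by
        by_contra hp2
        exact hsq p hp hp2 (hpp.trans hd)
      rcases k with _ | k
      · exact hK4
      · refine absurd (Dvd.dvd.trans ?_ hd) h8
        rw [show k + 1 + 2 = k + 3 by ring, pow_add]
        exact Dvd.intro_left _ rfl
  have hprime : ∀ p : ℕ, p.Prime → p ∣ N → p = 2 ∨ p = 3 ∨ p = 5 ∨ p = 7 := fun p hp hd => by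
    have := hlarge p hp hd
    have := hp.two_le
    interval_cases p <;> first | omega | exact absurd hp (by norm_num)
  by_cases h7 : 7 ∣ N
  · have h420 : N ∣ 420 := hdvd 420 (by norm_num) fun p hp hd => by
      rcases hprime p hp hd with rfl | rfl | rfl | rfl <;> norm_num
    obtain ⟨M, rfl⟩ := h7
    exact hnot (hφ.isListedCos_of_seven_dvd h1 h6 hN
      (Nat.dvd_of_mul_dvd_mul_left (by norm_num : 0 < 7) h420))
  · have h60 : N ∣ 60 := hdvd 60 (by norm_num) fun p hp hd => by
      rcases hprime p hp hd with rfl | rfl | rfl | rfl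
      · norm_num
      · norm_num
      · norm_num
      · exact absurd hd h7
    obtain ⟨m, hm⟩ := h60
    choose k hk using hint
    refine hnot (hφ.isListedCos_of_denominator_sixty h2 h6 (fun j => k j * m) (fun j => ?_) ?_)
    · push_cast
      rw [← hk j, mul_assoc]
      congr 1
      exact_mod_cast hm
    -- If 4 divides N, the numerators over N are odd, and 60/N is odd too. If not, 60/N is even.
    -- Either way the numerators over 60 share one parity.
    · by_cases h4 : 4 ∣ N
      · right
        intro j hd
        have hodd := hφ.odd_of_four_dvd hN h4 hk j
        rcases Int.prime_two.dvd_or_dvd hd with hd | hd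
        · exact hodd hd
        · obtain ⟨u, hu⟩ := h4
          obtain ⟨v, hv⟩ : 2 ∣ m := by exact_mod_cast hd
          rw [hu, hv] at hm
          have : 8 * (u * v) = 60 := by rw [hm]; ring
          omega
      · left
        intro j
        refine Dvd.dvd.mul_left ?_ _
        by_contra hd
        have hm2 : ¬ 2 ∣ m := fun h => hd (by exact_mod_cast h)
        refine h4 ?_
        have hcop : Nat.Coprime 4 m := by
          have := (Nat.Prime.coprime_iff_not_dvd Nat.prime_two).2 hm2
          exact Nat.Coprime.pow_left 2 this
        exact hcop.dvd_of_dvd_mul_right (hm ▸ (by norm_num : 4 ∣ 60))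

/-! ### Irreducibility and inequivalence of the listed tuples. -/

theorem eq_num_div {x : ℚ} (h : (x * 4620).den = 1) : x = ((x * 4620).num : ℚ) / 4620 := by
  rw [eq_div_iff (by norm_num)]
  exact (Rat.den_eq_one_iff _).1 h |>.symm

/-- The parameter 0 suffices, because another parameter only rotates the tuple. A nonzero residue
certifies a nonzero subsum. -/
theorem expFamilies_residues : ∀ n ≤ 6, ∀ F ∈ expFamilies n,
    (∀ j, (F 0 j * 4620).den = 1) ∧ ∀ E : Finset (Fin n), E.Nonempty → E ≠ Finset.univ →
      (∑ j ∈ E, expResidue (F 0 j * 4620).num) % 9241 ≠ 0 := by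
  decide +kernel

theorem cosSporadic_residues : ∀ n ≤ 6, ∀ ψ ∈ cosSporadic n,
    (∀ j, (ψ j * 4620).den = 1) ∧ ∀ E : Finset (Fin n), E.Nonempty → E ≠ Finset.univ →
      (∑ j ∈ E, cosResidue (ψ j * 4620).num) % 9241 ≠ 0 := by
  decide +kernel

/-- A numerical invariant of the equivalence for the cosine equation. -/
def cosInvariant {n : ℕ} (φ : Fin n → ℚ) : ℚ := ∑ j, foldRat (2 * φ j) ^ 2

theorem cosSporadic_pairwise_cosInvariant : ∀ n ≤ 6,
    (cosSporadic n).Pairwise fun ψ ψ' => cosInvariant ψ ≠ cosInvariant ψ' := by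
  decide +kernel

/-- If a family member is equivalent to ψ, its first entry is ±ψⱼ modulo 1/2 for some j. The
invariant has period 1/2 in the parameter, so these finitely many parameters are the only ones to
exclude. -/
theorem cosInvariant_cosFamilies : ∀ n ≤ 6, ∀ ψ ∈ cosSporadic n, ∀ F ∈ cosFamilies n,
    ∀ i j : Fin n, i.val = 0 → cosInvariant (F (ψ j - F 0 i)) ≠ cosInvariant ψ ∧
      cosInvariant (F (-ψ j - F 0 i)) ≠ cosInvariant ψ := by
  decide +kernel

theorem foldRat_mem (x : ℚ) : 0 ≤ foldRat x ∧ foldRat x ≤ 1 / 2 := by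
  have h1 : (x.floor : ℚ) ≤ x := Rat.floor_le x
  have h2 : x < x.floor + 1 := by exact_mod_cast Rat.lt_floor_add_one x
  rw [foldRat]
  rcases le_total (x - x.floor) (1 - (x - x.floor)) with h | h
  · rw [min_eq_left h]; constructor <;> linarith
  · rw [min_eq_right h]; constructor <;> linarith

theorem foldRat_eq_of_cosRat_eq {x y : ℚ} (h : cosRat x = cosRat y) : foldRat x = foldRat y := by
  obtain ⟨hx0, hx1⟩ := foldRat_mem x
  obtain ⟨hy0, hy1⟩ := foldRat_mem y
  rw [← cosRat_foldRat x, ← cosRat_foldRat y, cosRat_eq_iff] at h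
  generalize foldRat x = u at *
  generalize foldRat y = v at *
  obtain ⟨m, h | h⟩ := h
  · have h1 : (-1 : ℚ) < m := by linarith
    have h2 : (m : ℚ) < 1 := by linarith
    have h1 : -1 < m := by exact_mod_cast h1
    have h2 : m < 1 := by exact_mod_cast h2
    obtain rfl : m = 0 := by omega
    simpa using h
  · have h1 : (-1 : ℚ) < m := by linarith
    have h2 : (m : ℚ) < 2 := by linarith
    have h1 : -1 < m := by exact_mod_cast h1
    have h2 : m < 2 := by exact_mod_cast h2
    obtain rfl | rfl : m = 0 ∨ m = 1 := by omega
    · push_cast at h; linarith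
    · push_cast at h; linarith

/-- Doubling turns 1/2 - φⱼ into 1 - 2φⱼ, which folds to the same number as 2φⱼ. -/
theorem CosEquiv.cosInvariant_eq {n : ℕ} {φ ψ : Fin n → ℚ} (h : CosEquiv φ ψ) :
    cosInvariant ψ = cosInvariant φ := by
  obtain ⟨σ, h⟩ := h
  rw [cosInvariant, cosInvariant, ← Equiv.sum_comp σ fun j => foldRat (2 * φ j) ^ 2]
  refine Finset.sum_congr rfl fun j _ => ?_
  congr 1
  refine foldRat_eq_of_cosRat_eq (cosRat_eq_iff.2 ?_)
  rcases h with h | h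
  · rcases h j with ⟨m, h⟩ | ⟨m, h⟩
    · exact ⟨2 * m, Or.inl (by rw [h]; push_cast; ring)⟩
    · exact ⟨2 + 2 * m, Or.inr (by rw [h]; push_cast; ring)⟩
  · rcases h j with ⟨m, h⟩ | ⟨m, h⟩
    · exact ⟨1 + 2 * m, Or.inr (by rw [h]; push_cast; ring)⟩
    · exact ⟨1 + 2 * m, Or.inl (by rw [h]; push_cast; ring)⟩

theorem not_cosEquiv_of_mem_cosSporadic {n : ℕ} (h3 : 3 ≤ n) (h6 : n ≤ 6) {ψ : Fin n → ℚ}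
    (hψ : ψ ∈ cosSporadic n) {F : ℚ → Fin n → ℚ} (hF : F ∈ cosFamilies n) (θ : ℚ) :
    ¬ CosEquiv (F θ) ψ := by
  intro h
  have hinv := h.cosInvariant_eq
  set i : Fin n := ⟨0, by omega⟩
  -- The pair family is not a family of translates; it is excluded by n ≥ 3.
  have hadd : ∀ (θ c : ℚ) (j : Fin n), F (θ + c) j = F θ j + c := by
    intro θ c j
    interval_cases n <;> simp only [cosFamilies, List.mem_singleton, List.not_mem_nil] at hF <;>
      subst hF <;> fin_cases j <;> simp <;> ring
  have hperiod : ∀ (x : ℚ) (m : ℤ), cosInvariant (F (x + m / 2)) = cosInvariant (F x) := by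
    intro x m
    refine Finset.sum_congr rfl fun j _ => ?_
    congr 1
    refine foldRat_eq_of_cosRat_eq (cosRat_eq_iff.2 ⟨m, Or.inl ?_⟩)
    rw [hadd]; ring
  have hθ : F θ i = F 0 i + θ := by rw [← hadd, zero_add]
  obtain ⟨σ, h⟩ := h
  have hnot := cosInvariant_cosFamilies n h6 ψ hψ F hF i (σ.symm i) rfl
  have hcand : ∃ m : ℤ, θ = (ψ (σ.symm i) - F 0 i) + m / 2 ∨
      θ = (-ψ (σ.symm i) - F 0 i) + m / 2 := by
    rcases h with h | h <;> have h := h (σ.symm i) <;> rw [Equiv.apply_symm_apply, hθ] at h <;>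
      rcases h with ⟨m, h⟩ | ⟨m, h⟩
    · exact ⟨-2 * m, Or.inl (by rw [h]; push_cast; ring)⟩
    · exact ⟨2 + 2 * m, Or.inr (by rw [h]; push_cast; ring)⟩
    · exact ⟨1 + 2 * m, Or.inr (by rw [h]; push_cast; ring)⟩
    · exact ⟨-1 - 2 * m, Or.inl (by rw [h]; push_cast; ring)⟩
  obtain ⟨m, h | h⟩ := hcand <;> rw [h, hperiod] at hinv
  · exact hnot.1 hinv.symm
  · exact hnot.2 hinv.symm

theorem irreducibleExp_expFamilies {n : ℕ} (h6 : n ≤ 6) {F : ℚ → Fin n → ℚ}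
    (hF : F ∈ expFamilies n) (θ : ℚ) : IrreducibleExp (F θ) := by
  obtain ⟨hden, hne⟩ := expFamilies_residues n h6 F hF
  have h0 : IrreducibleExp (F 0) := by
    refine ⟨sum_expFamily h6 hF 0, fun E h1 h2 h3 => hne E h1 h2 ?_⟩
    refine sum_expResidue_mod E _ ?_
    rw [← h3]
    refine Finset.sum_congr rfl fun j _ => ?_
    rw [← eq_num_div (hden j)]; rfl
  exact h0.of_mul (expRat_ne_zero θ) fun j => by
    rw [← expRat_add, ← zero_add θ, expFamilies_add h6 hF, zero_add, add_comm]

/-! ### Vanishing of the listed sums, and the finitely many reducible members. -/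

theorem cosRat_eleven : cosRat (1 / 11) + cosRat (2 / 11) + cosRat (3 / 11) + cosRat (4 / 11) +
    cosRat (5 / 11) = -1 / 2 := by
  have h := sum_range_cosRat 11 (by norm_num) 0
  have hs : ∀ x : ℚ, cosRat (1 - x) = cosRat x := fun x => by
    rw [← cosRat_neg x, ← cosRat_add_int (-x) 1]; congr 1; push_cast; ring
  have h6 := hs (5 / 11)
  have h7 := hs (4 / 11)
  have h8 := hs (3 / 11)
  have h9 := hs (2 / 11)
  have h10 := hs (1 / 11)
  norm_num [Finset.sum_range_succ, cosRat_zero] at h h6 h7 h8 h9 h10 ⊢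
  linarith

theorem cosRat_seven : cosRat (1 / 7) + cosRat (2 / 7) + cosRat (3 / 7) = -1 / 2 := by
  have h := sum_range_cosRat 7 (by norm_num) 0
  have hs : ∀ x : ℚ, cosRat (1 - x) = cosRat x := fun x => by
    rw [← cosRat_neg x, ← cosRat_add_int (-x) 1]; congr 1; push_cast; ring
  have h4 := hs (3 / 7)
  have h5 := hs (2 / 7)
  have h6 := hs (1 / 7)
  norm_num [Finset.sum_range_succ, cosRat_zero] at h h4 h5 h6 ⊢
  linarith

theorem cosRat_sixth_shift (x : ℚ) : cosRat (x + 1 / 6) + cosRat (x - 1 / 6) = cosRat x := by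
  rw [← expRat_re, ← expRat_re, ← expRat_re, ← Complex.add_re, sub_eq_add_neg, expRat_add,
    expRat_add, ← mul_add, expRat_sixth_pair, mul_one]

theorem sum_eq_of_foldRat_isPerm {n : ℕ} {ψ : Fin n → ℚ} {l : List ℚ}
    (h : ((List.ofFn ψ).map foldRat).isPerm (l.map foldRat) = true) :
    ∑ j, cosRat (ψ j) = (l.map cosRat).sum := by
  have := congrArg Multiset.sum (cosMultiset_eq_of_foldRat_isPerm h)
  rwa [cosMultiset, sum_sum_singleton] at this

/-- Pieces of the sporadic solutions, with the sums of the cosines. -/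
theorem sum_halfSolutions {l : List ℕ} (hl : l ∈ halfSolutions) :
    (l.map fun k : ℕ => cosRat (k / 60)).sum = 1 / 2 := by
  have h6 := cosRat_sixth
  have h10 := cosRat_tenths
  have h3 := cosRat_third
  have h5 := cosRat_fifths
  have h0 := cosRat_zero
  simp only [halfSolutions, List.mem_cons, List.not_mem_nil, or_false] at hl
  rcases hl with rfl | rfl | rfl | rfl | rfl | rfl
  · norm_num at h6 ⊢; exact h6
  · norm_num at h10 ⊢; exact h10
  · norm_num [h0] at h3 ⊢; linarith
  -- The triple relation at 1/15 replaces the cosines at 1/15 and 4/15 by minus the one at 2/5, that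
  -- is, by the cosine at 1/10. The case of 2/15 and 7/15 below is analogous, with 3/10.
  · have e1 := cosRat_third_shift (1 / 15)
    have e2 := cosRat_fifths
    have e3 : cosRat (11 / 15) = cosRat (4 / 15) := by
      rw [← cosRat_neg, ← cosRat_add_int (-(11 / 15)) 1]; norm_num
    have e4 := cosRat_half_sub (1 / 5)
    have e5 := h10
    have e6 := cosRat_half_sub (2 / 5)
    norm_num at e1 e2 e3 e4 e5 e6 ⊢
    linarith
  · norm_num [h0] at h5 ⊢; linarith
  · have e1 := cosRat_third_shift (2 / 15)
    have e2 := cosRat_fifths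
    have e3 : cosRat (4 / 5) = cosRat (1 / 5) := by
      rw [← cosRat_neg, ← cosRat_add_int (-(4 / 5)) 1]; norm_num
    have e4 := cosRat_half_sub (1 / 5)
    have e5 := h10
    have e6 := cosRat_half_sub (2 / 5)
    norm_num at e1 e2 e3 e4 e5 e6 ⊢
    linarith

theorem sum_classAngles {c : ℚ} {l : List ℚ} (hl : l ∈ classAngles c) :
    (l.map cosRat).sum = cosRat (c / 7) := by
  simp only [classAngles, List.mem_cons, List.not_mem_nil, or_false] at hl
  rcases hl with rfl | rfl
  · simp
  · rw [← cosRat_sixth_shift (c / 7)]; simp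

/-- Explains why each sporadic sum vanishes: it is 1/2 - 1/2, or 1/2 plus the cosines at 1/7, 2/7,
3/7 (some replaced by a pair shifted by ±1/6), or the relation for 11. -/
theorem cosSporadic_decomposition : ∀ n ≤ 6, ∀ ψ ∈ cosSporadic n,
    (∃ l₀ ∈ halfSolutions, ∃ l₁ ∈ halfSolutions, ((List.ofFn ψ).map foldRat).isPerm
      ((l₀.map (fun k : ℕ => (k / 60 : ℚ)) ++ l₁.map (fun k : ℕ => (1 / 2 - k / 60 : ℚ))).map
        foldRat) = true) ∨
    (∃ l₀ ∈ halfSolutions, ∃ l₁ ∈ classAngles 1, ∃ l₂ ∈ classAngles 2, ∃ l₃ ∈ classAngles 3,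
      ((List.ofFn ψ).map foldRat).isPerm
        ((l₀.map (fun k : ℕ => (k / 60 : ℚ)) ++ (l₁ ++ (l₂ ++ l₃))).map foldRat) = true) ∨
    ((List.ofFn ψ).map foldRat).isPerm
      ([1 / 11, 2 / 11, 3 / 11, 4 / 11, 5 / 11, 1 / 6].map foldRat) = true := by
  decide +kernel

theorem irreducibleCos_cosSporadic {n : ℕ} (h6 : n ≤ 6) {ψ : Fin n → ℚ}
    (hψ : ψ ∈ cosSporadic n) : IrreducibleCos ψ := by
  obtain ⟨hden, hne⟩ := cosSporadic_residues n h6 ψ hψ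
  refine ⟨?_, fun E h1 h2 h3 => hne E h1 h2 ?_⟩
  · change ∑ j, cosRat (ψ j) = 0
    rcases cosSporadic_decomposition n h6 ψ hψ with
      ⟨l₀, h₀, l₁, h₁, h⟩ | ⟨l₀, h₀, l₁, h₁, l₂, h₂, l₃, h₃, h⟩ | h
    · have e₀ := sum_halfSolutions h₀
      have e₁ := sum_halfSolutions h₁
      rw [sum_eq_of_foldRat_isPerm h, List.map_append, List.sum_append, List.map_map, List.map_map]
      have : (cosRat ∘ fun k : ℕ => (1 / 2 - k / 60 : ℚ)) = fun k : ℕ => -cosRat (k / 60) :=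
        funext fun k => cosRat_half_sub _
      have hneg : ∀ l : List ℕ, (l.map fun k : ℕ => -cosRat (k / 60)).sum =
          -(l.map fun k : ℕ => cosRat (k / 60)).sum := fun l => by
        induction l with
        | nil => simp
        | cons k l ih => simp only [List.map_cons, List.sum_cons, ih]; ring
      rw [this, hneg, e₁, Function.comp_def, e₀]
      norm_num
    · have e₀ := sum_halfSolutions h₀
      have e₁ := sum_classAngles h₁
      have e₂ := sum_classAngles h₂
      have e₃ := sum_classAngles h₃
      have := cosRat_seven
      rw [sum_eq_of_foldRat_isPerm h, List.map_append, List.map_append, List.map_append,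
        List.sum_append, List.sum_append, List.sum_append, List.map_map, e₁, e₂, e₃,
        Function.comp_def, e₀]
      linarith
    · have := cosRat_eleven
      have h1 := cosRat_sixth
      rw [sum_eq_of_foldRat_isPerm h]
      simp only [List.map_cons, List.map_nil, List.sum_cons, List.sum_nil]
      linarith
  · refine sum_cosResidue_mod E _ ?_
    rw [← h3]
    refine Finset.sum_congr rfl fun j _ => ?_
    rw [← eq_num_div (hden j)]; rfl

theorem exists_expFamily_of_mem_cosFamilies {n : ℕ} (h6 : n ≤ 6) {G : ℚ → Fin n → ℚ}
    (hG : G ∈ cosFamilies n) : ∃ F ∈ expFamilies n, ∃ τ : Equiv.Perm (Fin n),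
      ∀ θ j, cosRat (G θ j) = cosRat (F θ (τ j)) := by
  interval_cases n <;> simp only [cosFamilies, List.mem_singleton, List.not_mem_nil] at hG <;>
    subst hG
  · refine ⟨_, List.mem_singleton_self _, 1, fun θ j => ?_⟩
    fin_cases j
    · rfl
    · exact (cosRat_half_sub θ).trans (cosRat_add_half θ).symm
  · refine ⟨_, List.mem_singleton_self _, 1, fun θ j => ?_⟩
    fin_cases j
    · rfl
    · rfl
    · change cosRat (θ - 1 / 3) = cosRat (θ + 2 / 3)
      rw [← cosRat_add_int (θ - 1 / 3) 1]; congr 1; push_cast; ring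
  · exact ⟨_, List.mem_singleton_self _, 1, fun θ j => rfl⟩
  · refine ⟨_, List.mem_singleton_self _, Equiv.swap 0 1, fun θ j => ?_⟩
    fin_cases j <;> rfl

theorem sum_cosRat_cosFamilies {n : ℕ} (h6 : n ≤ 6) {G : ℚ → Fin n → ℚ}
    (hG : G ∈ cosFamilies n) (θ : ℚ) : ∑ j, cosRat (G θ j) = 0 := by
  obtain ⟨F, hF, τ, hτ⟩ := exists_expFamily_of_mem_cosFamilies h6 hG
  simp only [hτ]
  rw [Equiv.sum_comp τ fun j => cosRat (F θ j)]
  have := congrArg Complex.re (sum_expFamily h6 hF θ)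
  simpa only [Complex.re_sum, expRat_re, Complex.zero_re] using this

/-- A vanishing real part means e(θ)² = -z̄/z, which has at most two solutions e(θ), and e is
injective on [0, 1). -/
theorem finite_setOf_re_expRat_mul_eq_zero {z : ℂ} (hz : z ≠ 0) :
    {θ : ℚ | 0 ≤ θ ∧ θ < 1 ∧ (expRat θ * z).re = 0}.Finite := by
  refine Set.Finite.of_finite_image (f := expRat) ?_ ?_
  · refine (Polynomial.nthRoots 2 (-(starRingEnd ℂ) z / z)).toFinset.finite_toSet.subset ?_
    rintro _ ⟨θ, ⟨-, -, h⟩, rfl⟩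
    rw [Finset.mem_coe, Multiset.mem_toFinset, Polynomial.mem_nthRoots (by norm_num)]
    have h1 := Complex.add_conj (expRat θ * z)
    rw [h, map_mul, conj_expRat] at h1
    have h2 := expRat_mul_neg θ
    rw [eq_div_iff hz]
    push_cast at h1
    linear_combination expRat θ * h1 - (starRingEnd ℂ) z * h2
  · rintro x ⟨hx0, hx1, -⟩ y ⟨hy0, hy1, -⟩ h
    obtain ⟨m, hm⟩ := expRat_eq_iff.1 h
    have h1 : (-1 : ℚ) < m := by linarith
    have h2 : (m : ℚ) < 1 := by linarith
    have h1 : -1 < m := by exact_mod_cast h1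
    have h2 : m < 1 := by exact_mod_cast h2
    obtain rfl : m = 0 := by omega
    simpa using hm

/-- Each cosine subsum in a family is the real part of e(θ) times an exponential subsum at parameter
0, nonzero for proper subsets by `irreducibleExp_expFamilies`. There are finitely many subsets. -/
theorem finite_not_irreducibleCos {n : ℕ} (h6 : n ≤ 6) {G : ℚ → Fin n → ℚ}
    (hG : G ∈ cosFamilies n) : {θ : ℚ | 0 ≤ θ ∧ θ < 1 ∧ ¬ IrreducibleCos (G θ)}.Finite := by
  obtain ⟨F, hF, τ, hτ⟩ := exists_expFamily_of_mem_cosFamilies h6 hG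
  have hirr := irreducibleExp_expFamilies h6 hF 0
  have hfin : (⋃ E ∈ {E : Finset (Fin n) | E.Nonempty ∧ E ≠ Finset.univ},
      {θ : ℚ | 0 ≤ θ ∧ θ < 1 ∧ (expRat θ * ∑ j ∈ E, expRat (F 0 (τ j))).re = 0}).Finite := by
    refine Set.Finite.biUnion (Set.toFinite _) fun E hE => finite_setOf_re_expRat_mul_eq_zero ?_
    have h := hirr.2 (E.map τ.toEmbedding) hE.1.map fun h => hE.2 (by
      rw [← Finset.card_eq_iff_eq_univ] at h ⊢
      simpa using h)
    rw [Finset.sum_map] at h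
    exact h
  refine hfin.subset ?_
  rintro θ ⟨h0, h1, h⟩
  have h2 : ¬ ∀ E : Finset (Fin n), E.Nonempty → E ≠ Finset.univ →
      ∑ j ∈ E, cosRat (G θ j) ≠ 0 := fun h2 => h ⟨sum_cosRat_cosFamilies h6 hG θ, h2⟩
  push Not at h2
  obtain ⟨E, hE, hne, h2⟩ := h2
  refine Set.mem_biUnion (show E ∈ {E : Finset (Fin n) | _} from ⟨hE, hne⟩) ⟨h0, h1, ?_⟩
  rw [← h2, Finset.mul_sum, Complex.re_sum]
  refine Finset.sum_congr rfl fun j _ => ?_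
  rw [hτ, ← expRat_re, ← expRat_add]
  congr 2
  rw [add_comm, ← expFamilies_add h6 hF, zero_add]

theorem mainTheorem4 :
    -- the irreducible solutions of the exponential equation with at most six terms
    (∀ n : ℕ, 1 ≤ n → n ≤ 6 → ∀ φ : Fin n → ℚ,
      IrreducibleExp φ ↔ ∃ F ∈ expFamilies n, ∃ θ : ℚ, ExpEquiv (F θ) φ) ∧
    -- the irreducible solutions of the cosine equation with two to six terms
    (∀ n : ℕ, 1 < n → n ≤ 6 →
      -- completeness of the list
      (∀ φ : Fin n → ℚ, IrreducibleCos φ →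
        (∃ ψ ∈ cosSporadic n, CosEquiv ψ φ) ∨
        (∃ F ∈ cosFamilies n, ∃ θ : ℚ, CosEquiv (F θ) φ)) ∧
      -- the sporadic tuples are irreducible solutions, pairwise inequivalent,
      -- and inequivalent to the members of the families
      (∀ ψ ∈ cosSporadic n, IrreducibleCos ψ) ∧
      (cosSporadic n).Pairwise (fun ψ ψ' => ¬ CosEquiv ψ ψ') ∧
      (∀ ψ ∈ cosSporadic n, ∀ F ∈ cosFamilies n, ∀ θ : ℚ, ¬ CosEquiv (F θ) ψ) ∧
      -- all members of the families are solutions,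
      -- irreducible ones with finitely many exceptions modulo 1
      (∀ F ∈ cosFamilies n,
        (∀ θ : ℚ, ∑ j, Real.cos (2 * Real.pi * (F θ j : ℝ)) = 0) ∧
        {θ : ℚ | 0 ≤ θ ∧ θ < 1 ∧ ¬ IrreducibleCos (F θ)}.Finite)) := by
  refine ⟨fun n h1 h6 φ => ⟨fun h => h.isListedExp h1 h6, ?_⟩, fun n h2 h6 =>
    ⟨fun φ h => (h.isListedCos h2 h6).cosEquiv, fun ψ hψ => irreducibleCos_cosSporadic h6 hψ,
      (cosSporadic_pairwise_cosInvariant n h6).imp fun h h' => h h'.cosInvariant_eq.symm,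
      fun ψ hψ F hF θ => ?_,
      fun F hF => ⟨sum_cosRat_cosFamilies h6 hF, finite_not_irreducibleCos h6 hF⟩⟩⟩
  · rintro ⟨F, hF, θ, h⟩
    exact (irreducibleExp_expFamilies h6 hF θ).of_multiset_eq (expEquiv_iff.1 h)
  · refine not_cosEquiv_of_mem_cosSporadic ?_ h6 hψ hF θ
    by_contra hn
    obtain rfl : n = 2 := by omega
    simp [cosSporadic] at hψ
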